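/- Let $M$ be a connected (Hausdorff, second countable, boundaryless) smooth manifold of dimension $n$. Let $-\infty\le\alpha<0<\omega\le\infty$ and let $(g(t))_{t\in(\alpha,\omega)}$ be a smooth solution of the Ricci flow $\frac{\partial}{\partial t}g(t)=-2\,\mathrm{Ric}(g(t))$ on $M$ with $g(0)=g_0$, for example a solution with maximal interval of definition $(\alpha,\omega)$ (neither completeness nor maximality is needed). Suppose that for each $t\in(\alpha,\omega)$ the scalar curvature $R(g(t))$ is constant on $M$. Then: (i) if $R(g_0)>0$, then $\omega\le\frac n2\,R(g_0)^{-1}$ (in particular $\omega<\infty$); (ii) if $R(g_0)<0$, then $\alpha\ge\frac n2\,R(g_0)^{-1}$ (in particular $\alpha>-\infty$). -/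

import Mathlib

open scoped Manifold ContDiff

noncomputable section

namespace RicciFlow

/-! ### Curvature in local coordinates

`G : ℝⁿ → Matrix` is the matrix `(g_{ij})` of a metric in a coordinate system. -/

section Coordinates

variable {n : ℕ}

/-- The partial derivative `∂_i f (y)` of a function on `ℝⁿ`. -/
def pderiv (i : Fin n) (f : EuclideanSpace ℝ (Fin n) → ℝ) (y : EuclideanSpace ℝ (Fin n)) : ℝ :=
  fderiv ℝ f y (EuclideanSpace.single i 1)

/-- The Christoffel symbols
`Γ^k_{ij} = (1/2) ∑_l g^{kl} (∂_i g_{jl} + ∂_j g_{il} - ∂_l g_{ij})`. -/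
def christoffel (G : EuclideanSpace ℝ (Fin n) → Matrix (Fin n) (Fin n) ℝ) (k i j : Fin n)
    (y : EuclideanSpace ℝ (Fin n)) : ℝ :=
  (1 / 2 : ℝ) * ∑ l, (G y)⁻¹ k l *
    (pderiv i (fun z => G z j l) y + pderiv j (fun z => G z i l) y - pderiv l (fun z => G z i j) y)

/-- The components of the Ricci tensor,
`R_{jk} = ∑_i (∂_i Γ^i_{jk} - ∂_j Γ^i_{ik}) + ∑_{i,l} (Γ^i_{il} Γ^l_{jk} - Γ^i_{jl} Γ^l_{ik})`
(the sign is the one for which round spheres have positive Ricci curvature). -/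
def coordRicci (G : EuclideanSpace ℝ (Fin n) → Matrix (Fin n) (Fin n) ℝ)
    (y : EuclideanSpace ℝ (Fin n)) (j k : Fin n) : ℝ :=
  ∑ i, (pderiv i (christoffel G i j k) y - pderiv j (christoffel G i i k) y) +
    ∑ i, ∑ l, (christoffel G i i l y * christoffel G l j k y -
      christoffel G i j l y * christoffel G l i k y)

/-- The scalar curvature `R = ∑_{j,k} g^{jk} R_{jk}`. -/
def coordScalar (G : EuclideanSpace ℝ (Fin n) → Matrix (Fin n) (Fin n) ℝ)
    (y : EuclideanSpace ℝ (Fin n)) : ℝ :=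
  ∑ j, ∑ k, (G y)⁻¹ j k * coordRicci G y j k

end Coordinates

/-! ### Riemannian metrics on an `n`-dimensional manifold -/

/-- A smooth Riemannian metric on the `n`-dimensional smooth manifold `M`. -/
abbrev Metric (n : ℕ) (M : Type*) [TopologicalSpace M]
    [ChartedSpace (EuclideanSpace ℝ (Fin n)) M] [IsManifold (𝓡 n) ∞ M] :=
  Bundle.ContMDiffRiemannianMetric (𝓡 n) ∞ (EuclideanSpace ℝ (Fin n))
    (fun x : M => TangentSpace (𝓡 n) x)

section Manifold

variable {n : ℕ} {M : Type*} [TopologicalSpace M] [ChartedSpace (EuclideanSpace ℝ (Fin n)) M]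

/-- The coordinate vector field `∂_i` of the chart `e`, at the point with coordinates `y`. -/
def coordVector (e : OpenPartialHomeomorph M (EuclideanSpace ℝ (Fin n)))
    (y : EuclideanSpace ℝ (Fin n)) (i : Fin n) : TangentSpace (𝓡 n) (e.symm y) :=
  mfderiv (𝓡 n) (𝓡 n) e.symm y (EuclideanSpace.single i 1 : EuclideanSpace ℝ (Fin n))

variable [IsManifold (𝓡 n) ∞ M]

/-- The matrix `g_{ij} = g(∂_i, ∂_j)` of the metric `g` in the chart `e`, as a function of the
coordinates; only its values on `e.target` are meaningful. -/
def metricMatrix (g : Metric n M) (e : OpenPartialHomeomorph M (EuclideanSpace ℝ (Fin n)))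
    (y : EuclideanSpace ℝ (Fin n)) : Matrix (Fin n) (Fin n) ℝ :=
  Matrix.of fun i j => g.inner (e.symm y) (coordVector e y i) (coordVector e y j)

/-- The scalar curvature `R(g)` at the point `x`, computed in the preferred chart around `x`
(every other chart around `x` gives the same value). -/
def scalarCurvature (g : Metric n M) (x : M) : ℝ :=
  coordScalar (metricMatrix g (chartAt (EuclideanSpace ℝ (Fin n)) x))
    (chartAt (EuclideanSpace ℝ (Fin n)) x x)

/-- `g(t)`, for `t` in the open set of times `T`, is a smooth solution of the Ricci flow
`∂g/∂t = -2 Ric(g(t))` on `M`: in every smooth chart the components `g_{ij}(t, y)` are jointly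
smooth in time and space and satisfy `∂_t g_{ij} = -2 R_{ij}`. -/
structure IsRicciFlow (g : ℝ → Metric n M) (T : Set ℝ) : Prop where
  smooth : ∀ e ∈ IsManifold.maximalAtlas (𝓡 n) ∞ M, ∀ i j : Fin n,
    ContDiffOn ℝ ∞
      (fun p : ℝ × EuclideanSpace ℝ (Fin n) => metricMatrix (g p.1) e p.2 i j) (T ×ˢ e.target)
  flow : ∀ e ∈ IsManifold.maximalAtlas (𝓡 n) ∞ M, ∀ t ∈ T, ∀ y ∈ e.target, ∀ i j : Fin n,
    HasDerivAt (fun s : ℝ => metricMatrix (g s) e y i j)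
      (-2 * coordRicci (metricMatrix (g t) e) y i j) t

end Manifold

/-- The open time interval `(α, β)`, with possibly infinite end points. -/
def timeInterval (α β : EReal) : Set ℝ := {t : ℝ | α < (t : EReal) ∧ (t : EReal) < β}

end RicciFlow

end

/-!
Under the Ricci flow the scalar curvature satisfies `∂_t R = ΔR + 2|Ric|²`. If `R` is constant in
space the Laplacian vanishes, and `|Ric|² ≥ R²/n` by the Cauchy-Schwarz inequality, so that the
function `r(t) = R(g(t))` satisfies the Riccati inequality `r' ≥ (2/n) r²`. Hence
`1/r + (2/n) t` is non-increasing while `r > 0`, and `r` cannot stay finite beyond the time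
`n / (2 r(0))` (`le_of_riccati`); the case `r(0) < 0` follows by reversing time.

The evolution equation is only needed for spatially constant `R`, and is proved in a single chart.
The Christoffel symbols are organised in connection matrices `A_i = (Γ^k_{ij})_{kj}`, for which
metric compatibility reads `∂_i G = A_iᵀ G + G A_i` and the curvature is
`F_{ij} = ∂_i A_j - ∂_j A_i + [A_i, A_j]`. Uniqueness of the Levi-Civita connection
(`IsCoordMetric.conn_unique`) gives the transformation law of `Γ` under a change of coordinates,
from which the tensoriality of the curvature, and the invariance of the scalar curvature
(`IsCoordChange.scalar_pull`), follow by differentiation.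

The time derivative `∂_t Γ` of the connection is a tensor, so identities for it may be checked at
the centre of normal coordinates, which always exist (`IsCoordMetric.exists_normal`). There, the
contracted second Bianchi identity and the spatial constancy of `R` give `∂_t Γ^j_{ij} = 0`
(`IsLocalFlow.trace_connDot`) and `g^{ij} ∂_t Γ^k_{ij} = 0` (`IsLocalFlow.contract_connDot`). Once
these are known at all points, they may be differentiated; the divergence terms in
`∂_t (g^{jk} R_{jk})` then vanish at the centre of normal coordinates, and what remains is
`2 |Ric|²` (`IsLocalFlow.hasDerivAt_scalar_normal`).
-/

namespace RicciFlow

open scoped Topology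

/-- Coordinate space `ℝⁿ`. -/
abbrev Coord (n : ℕ) := EuclideanSpace ℝ (Fin n)

/-- Square matrices indexed by the coordinates. -/
abbrev Mat (n : ℕ) := Matrix (Fin n) (Fin n) ℝ

variable {n : ℕ}

/-! ### Partial derivatives -/

section Pderiv

variable {f h : Coord n → ℝ} {U : Set (Coord n)} {y : Coord n} (i j : Fin n)

lemma pderiv_congr (e : f =ᶠ[𝓝 y] h) : pderiv i f y = pderiv i h y := by
  simp only [pderiv, e.fderiv_eq]

lemma pderiv_congr_on (hU : IsOpen U) (hy : y ∈ U) (e : ∀ z ∈ U, f z = h z) :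
    pderiv i f y = pderiv i h y :=
  pderiv_congr i (Filter.eventuallyEq_of_mem (hU.mem_nhds hy) e)

lemma pderiv_const (c : ℝ) : pderiv i (fun _ : Coord n => c) y = 0 := by
  simp [pderiv]

lemma pderiv_add (hf : DifferentiableAt ℝ f y) (hh : DifferentiableAt ℝ h y) :
    pderiv i (fun z => f z + h z) y = pderiv i f y + pderiv i h y := by
  simp [pderiv, fderiv_fun_add hf hh]

lemma pderiv_sub (hf : DifferentiableAt ℝ f y) (hh : DifferentiableAt ℝ h y) :
    pderiv i (fun z => f z - h z) y = pderiv i f y - pderiv i h y := by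
  simp [pderiv, fderiv_fun_sub hf hh]

lemma pderiv_mul (hf : DifferentiableAt ℝ f y) (hh : DifferentiableAt ℝ h y) :
    pderiv i (fun z => f z * h z) y = pderiv i f y * h y + f y * pderiv i h y := by
  simp [pderiv, fderiv_fun_mul hf hh]; ring

lemma pderiv_const_mul (c : ℝ) (hf : DifferentiableAt ℝ f y) :
    pderiv i (fun z => c * f z) y = c * pderiv i f y := by
  simp [pderiv, fderiv_const_mul hf]

lemma pderiv_sum {ι : Type*} (s : Finset ι) {F : ι → Coord n → ℝ}
    (hF : ∀ a ∈ s, DifferentiableAt ℝ (F a) y) :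
    pderiv i (fun z => ∑ a ∈ s, F a z) y = ∑ a ∈ s, pderiv i (F a) y := by
  simp [pderiv, fderiv_fun_sum hF]

lemma smooth_differentiableAt {F : Type*} [NormedAddCommGroup F] [NormedSpace ℝ F]
    {f : F → ℝ} {U : Set F} {y : F} (hf : ContDiffOn ℝ ∞ f U) (hU : IsOpen U)
    (hy : y ∈ U) : DifferentiableAt ℝ f y :=
  (hf.contDiffAt (hU.mem_nhds hy)).differentiableAt (by simp)

lemma smooth_fderiv_apply {F : Type*} [NormedAddCommGroup F] [NormedSpace ℝ F]
    {f : F → ℝ} {U : Set F} (hf : ContDiffOn ℝ ∞ f U) (hU : IsOpen U) (v : F) :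
    ContDiffOn ℝ ∞ (fun y => fderiv ℝ f y v) U :=
  (hf.fderiv_of_isOpen hU (m := ∞) (by simp)).clm_apply contDiffOn_const

lemma fderiv_apply_comm {F : Type*} [NormedAddCommGroup F] [NormedSpace ℝ F]
    {f : F → ℝ} {U : Set F} {y : F} (hf : ContDiffOn ℝ ∞ f U) (hU : IsOpen U) (hy : y ∈ U)
    (v w : F) : fderiv ℝ (fun z => fderiv ℝ f z v) y w = fderiv ℝ (fun z => fderiv ℝ f z w) y v := by
  have h1 : DifferentiableAt ℝ (fderiv ℝ f) y :=
    ((hf.fderiv_of_isOpen hU (m := ∞) (by simp)).contDiffAt (hU.mem_nhds hy)).differentiableAt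
      (by simp)
  have h2 := (hf.contDiffAt (hU.mem_nhds hy)).isSymmSndFDerivAt
    (by simpa using WithTop.coe_le_coe.2 (le_top : (2 : ℕ∞) ≤ ⊤))
  rw [fderiv_clm_apply h1 (differentiableAt_const _), fderiv_clm_apply h1 (differentiableAt_const _)]
  simpa using h2 w v

lemma smooth_pderiv (hf : ContDiffOn ℝ ∞ f U) (hU : IsOpen U) :
    ContDiffOn ℝ ∞ (pderiv i f) U := smooth_fderiv_apply hf hU _

lemma pderiv_comm (hf : ContDiffOn ℝ ∞ f U) (hU : IsOpen U) (hy : y ∈ U) :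
    pderiv i (pderiv j f) y = pderiv j (pderiv i f) y := fderiv_apply_comm hf hU hy _ _

lemma fderiv_eq_sum_pderiv (f : Coord n → ℝ) (v : Coord n) :
    fderiv ℝ f y v = ∑ a, v a * pderiv a f y := by
  have hv : v = ∑ a, v a • EuclideanSpace.single a (1 : ℝ) := by
    ext k
    simp [Finset.sum_apply, Pi.single_apply]
  conv_lhs => rw [hv]
  simp [pderiv]

/-- The chain rule in coordinates. -/
lemma pderiv_comp {φ : Coord n → Coord n} (hf : DifferentiableAt ℝ f (φ y))
    (hφ : DifferentiableAt ℝ φ y) :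
    pderiv i (fun z => f (φ z)) y = ∑ a, pderiv i (fun z => φ z a) y * pderiv a f (φ y) := by
  have h1 : fderiv ℝ (fun z => f (φ z)) y = (fderiv ℝ f (φ y)).comp (fderiv ℝ φ y) :=
    fderiv_fun_comp y hf hφ
  rw [pderiv, h1, ContinuousLinearMap.comp_apply, fderiv_eq_sum_pderiv]
  refine Finset.sum_congr rfl fun a _ => ?_
  congr 1
  have h2 : fderiv ℝ (fun z => φ z a) y = (EuclideanSpace.proj a : Coord n →L[ℝ] ℝ).comp
      (fderiv ℝ φ y) :=
    ((EuclideanSpace.proj a : Coord n →L[ℝ] ℝ).hasFDerivAt.comp y hφ.hasFDerivAt).fderiv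
  rw [pderiv, h2]; rfl

lemma pderiv_coord (a : Fin n) : pderiv i (fun z : Coord n => z a) y = if a = i then 1 else 0 := by
  have h2 : fderiv ℝ (fun z : Coord n => z a) y = (EuclideanSpace.proj a : Coord n →L[ℝ] ℝ) :=
    (EuclideanSpace.proj a : Coord n →L[ℝ] ℝ).hasFDerivAt.fderiv
  rw [pderiv, h2]
  simp

end Pderiv

/-! ### Matrix-valued functions -/

section Matrices

variable {F : Type*} [NormedAddCommGroup F] [NormedSpace ℝ F]

/-- A matrix-valued function with smooth entries. -/
def SmoothMat (A : F → Mat n) (U : Set F) : Prop :=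
  ∀ a b, ContDiffOn ℝ ∞ (fun z => A z a b) U

variable {A B : F → Mat n} {U : Set F}

lemma SmoothMat.add (hA : SmoothMat A U) (hB : SmoothMat B U) :
    SmoothMat (fun z => A z + B z) U := fun a b => (hA a b).add (hB a b)

lemma SmoothMat.sub (hA : SmoothMat A U) (hB : SmoothMat B U) :
    SmoothMat (fun z => A z - B z) U := fun a b => (hA a b).sub (hB a b)

lemma SmoothMat.transpose (hA : SmoothMat A U) :
    SmoothMat (fun z => (A z).transpose) U := fun a b => hA b a

lemma SmoothMat.mul (hA : SmoothMat A U) (hB : SmoothMat B U) :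
    SmoothMat (fun z => A z * B z) U := fun a b => by
  simp only [Matrix.mul_apply]
  exact ContDiffOn.sum fun i _ => (hA a i).mul (hB i b)

lemma SmoothMat.sum_smul {f : Fin n → F → ℝ} {A : Fin n → F → Mat n}
    (hf : ∀ a, ContDiffOn ℝ ∞ (f a) U) (hA : ∀ a, SmoothMat (A a) U) :
    SmoothMat (fun z => ∑ a, f a z • A a z) U := fun a b => by
  simp only [Matrix.sum_apply, Matrix.smul_apply, smul_eq_mul]
  exact ContDiffOn.sum fun i _ => (hf i).mul (hA i a b)

lemma SmoothMat.det (hA : SmoothMat A U) : ContDiffOn ℝ ∞ (fun z => (A z).det) U := by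
  simp only [Matrix.det_apply]
  refine ContDiffOn.sum fun σ _ => ContDiffOn.const_smul _ ?_
  exact contDiffOn_prod fun i _ => hA _ _

lemma SmoothMat.inv (hA : SmoothMat A U) (h : ∀ z ∈ U, (A z).det ≠ 0) :
    SmoothMat (fun z => (A z)⁻¹) U := fun a b => by
  simp only [Matrix.inv_def, Ring.inverse_eq_inv', Matrix.smul_apply, smul_eq_mul]
  refine (hA.det.inv h).mul ?_
  simp only [Matrix.adjugate_apply]
  refine SmoothMat.det (A := fun z => (A z).updateRow b (Pi.single a 1)) fun k l => ?_
  by_cases hk : k = b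
  · subst hk
    simp only [Matrix.updateRow_self]
    exact contDiffOn_const
  · simpa only [Matrix.updateRow_ne hk] using hA k l

end Matrices

section Mpderiv

/-- The entrywise partial derivative of a matrix-valued function. -/
noncomputable def mpderiv (i : Fin n) (A : Coord n → Mat n) (y : Coord n) : Mat n :=
  Matrix.of fun a b => pderiv i (fun z => A z a b) y

variable {A B : Coord n → Mat n} {U : Set (Coord n)} {y : Coord n} (i j : Fin n)

lemma mpderiv_apply (a b : Fin n) : mpderiv i A y a b = pderiv i (fun z => A z a b) y := rfl

lemma SmoothMat.mpderiv (hA : SmoothMat A U) (hU : IsOpen U) : SmoothMat (mpderiv i A) U :=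
  fun a b => smooth_pderiv i (hA a b) hU

lemma mpderiv_congr (hU : IsOpen U) (hy : y ∈ U) (e : ∀ z ∈ U, A z = B z) :
    mpderiv i A y = mpderiv i B y := by
  ext a b
  exact pderiv_congr_on i hU hy fun z hz => by rw [e z hz]

lemma mpderiv_comm (hA : SmoothMat A U) (hU : IsOpen U) (hy : y ∈ U) :
    mpderiv i (mpderiv j A) y = mpderiv j (mpderiv i A) y := by
  ext a b
  exact pderiv_comm i j (hA a b) hU hy

lemma mpderiv_const (M : Mat n) : mpderiv i (fun _ => M) y = 0 := by
  ext a b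
  exact pderiv_const i _

lemma mpderiv_transpose : mpderiv i (fun z => (A z).transpose) y = (mpderiv i A y).transpose := rfl

lemma mpderiv_add (hA : SmoothMat A U) (hB : SmoothMat B U) (hU : IsOpen U) (hy : y ∈ U) :
    mpderiv i (fun z => A z + B z) y = mpderiv i A y + mpderiv i B y := by
  ext a b
  exact pderiv_add i (smooth_differentiableAt (hA a b) hU hy)
    (smooth_differentiableAt (hB a b) hU hy)

lemma mpderiv_sub (hA : SmoothMat A U) (hB : SmoothMat B U) (hU : IsOpen U) (hy : y ∈ U) :
    mpderiv i (fun z => A z - B z) y = mpderiv i A y - mpderiv i B y := by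
  ext a b
  exact pderiv_sub i (smooth_differentiableAt (hA a b) hU hy)
    (smooth_differentiableAt (hB a b) hU hy)

lemma mpderiv_mul (hA : SmoothMat A U) (hB : SmoothMat B U) (hU : IsOpen U) (hy : y ∈ U) :
    mpderiv i (fun z => A z * B z) y = mpderiv i A y * B y + A y * mpderiv i B y := by
  ext a b
  simp only [Matrix.add_apply, Matrix.mul_apply, mpderiv_apply]
  rw [pderiv_sum, ← Finset.sum_add_distrib]
  · exact Finset.sum_congr rfl fun c _ => pderiv_mul i (smooth_differentiableAt (hA a c) hU hy)
      (smooth_differentiableAt (hB c b) hU hy)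
  · exact fun c _ => (smooth_differentiableAt (hA a c) hU hy).mul
      (smooth_differentiableAt (hB c b) hU hy)

lemma mpderiv_sum_smul {f : Fin n → Coord n → ℝ} {A : Fin n → Coord n → Mat n}
    (hf : ∀ a, ContDiffOn ℝ ∞ (f a) U) (hA : ∀ a, SmoothMat (A a) U) (hU : IsOpen U)
    (hy : y ∈ U) :
    mpderiv i (fun z => ∑ a, f a z • A a z) y =
      ∑ a, (pderiv i (f a) y • A a y + f a y • mpderiv i (A a) y) := by
  ext p q
  simp only [mpderiv_apply, Matrix.sum_apply, Matrix.smul_apply, smul_eq_mul, Matrix.add_apply]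
  rw [pderiv_sum]
  · exact Finset.sum_congr rfl fun c _ => pderiv_mul i (smooth_differentiableAt (hf c) hU hy)
      (smooth_differentiableAt (hA c p q) hU hy)
  · exact fun c _ => (smooth_differentiableAt (hf c) hU hy).mul
      (smooth_differentiableAt (hA c p q) hU hy)

end Mpderiv

/-! ### Functions of time and space -/

section Time

/-- The time derivative of a time-dependent function on coordinate space. -/
noncomputable def tderiv (f : ℝ → Coord n → ℝ) (t : ℝ) (y : Coord n) : ℝ := deriv (fun s => f s y) t

/-- Joint smoothness in time and space. -/
def JointSmooth (f : ℝ → Coord n → ℝ) (T : Set ℝ) (U : Set (Coord n)) : Prop :=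
  ContDiffOn ℝ ∞ (fun p : ℝ × Coord n => f p.1 p.2) (T ×ˢ U)

variable {f h : ℝ → Coord n → ℝ} {T : Set ℝ} {U : Set (Coord n)} {t : ℝ} {y : Coord n}

lemma JointSmooth.space (hf : JointSmooth f T U) (ht : t ∈ T) : ContDiffOn ℝ ∞ (f t) U :=
  ContDiffOn.comp (g := fun p : ℝ × Coord n => f p.1 p.2) (f := fun z => (t, z)) hf
    (by fun_prop) fun _ hz => ⟨ht, hz⟩

lemma JointSmooth.add (hf : JointSmooth f T U) (hh : JointSmooth h T U) :
    JointSmooth (fun s z => f s z + h s z) T U := ContDiffOn.add hf hh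

lemma JointSmooth.sub (hf : JointSmooth f T U) (hh : JointSmooth h T U) :
    JointSmooth (fun s z => f s z - h s z) T U := ContDiffOn.sub hf hh

lemma JointSmooth.mul (hf : JointSmooth f T U) (hh : JointSmooth h T U) :
    JointSmooth (fun s z => f s z * h s z) T U := ContDiffOn.mul hf hh

lemma JointSmooth.const_mul (c : ℝ) (hf : JointSmooth f T U) :
    JointSmooth (fun s z => c * f s z) T U := ContDiffOn.mul contDiffOn_const hf

lemma JointSmooth.sum {ι : Type*} {s : Finset ι} {F : ι → ℝ → Coord n → ℝ}
    (hF : ∀ a ∈ s, JointSmooth (F a) T U) : JointSmooth (fun τ z => ∑ a ∈ s, F a τ z) T U :=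
  ContDiffOn.sum hF

section
variable (hT : IsOpen T) (hU : IsOpen U)
include hT hU

lemma JointSmooth.tderiv_eq (hf : JointSmooth f T U) (ht : t ∈ T) (hy : y ∈ U) :
    HasDerivAt (fun s => f s y)
      (fderiv ℝ (fun p : ℝ × Coord n => f p.1 p.2) (t, y) (1, 0)) t := by
  have h1 := (smooth_differentiableAt (y := (t, y)) hf (hT.prod hU) ⟨ht, hy⟩).hasFDerivAt
  exact h1.comp_hasDerivAt t ((hasDerivAt_id t).prodMk (hasDerivAt_const t y))

lemma JointSmooth.hasDerivAt (hf : JointSmooth f T U) (ht : t ∈ T) (hy : y ∈ U) :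
    HasDerivAt (fun s => f s y) (tderiv f t y) t :=
  (hf.tderiv_eq hT hU ht hy).differentiableAt.hasDerivAt

lemma JointSmooth.pderiv_eq (i : Fin n) (hf : JointSmooth f T U) (ht : t ∈ T) (hy : y ∈ U) :
    RicciFlow.pderiv i (f t) y = fderiv ℝ (fun p : ℝ × Coord n => f p.1 p.2) (t, y)
      (0, EuclideanSpace.single i 1) := by
  have h1 := (smooth_differentiableAt (y := (t, y)) hf (hT.prod hU) ⟨ht, hy⟩).hasFDerivAt
  have h2 := h1.comp y ((hasFDerivAt_const t y).prodMk (hasFDerivAt_id y))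
  have h3 : fderiv ℝ (f t) y = _ := h2.fderiv
  rw [RicciFlow.pderiv, h3]
  rfl

lemma JointSmooth.pderiv (i : Fin n) (hf : JointSmooth f T U) :
    JointSmooth (fun s z => pderiv i (f s) z) T U :=
  (smooth_fderiv_apply hf (hT.prod hU) (0, EuclideanSpace.single i 1)).congr
    fun _ hp => hf.pderiv_eq hT hU i hp.1 hp.2

lemma JointSmooth.tderiv (hf : JointSmooth f T U) : JointSmooth (tderiv f) T U :=
  (smooth_fderiv_apply hf (hT.prod hU) (1, 0)).congr
    fun _ hp => (hf.tderiv_eq hT hU hp.1 hp.2).deriv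

/-- Time and space derivatives commute. -/
lemma JointSmooth.tderiv_pderiv (i : Fin n) (hf : JointSmooth f T U) (ht : t ∈ T) (hy : y ∈ U) :
    RicciFlow.tderiv (fun s z => RicciFlow.pderiv i (f s) z) t y =
      RicciFlow.pderiv i (RicciFlow.tderiv f t) y := by
  have hTU := hT.prod hU
  have e1 : RicciFlow.tderiv (fun s z => RicciFlow.pderiv i (f s) z) t y = _ :=
    ((hf.pderiv hT hU i).tderiv_eq hT hU ht hy).deriv
  have e2 := (hf.tderiv hT hU).pderiv_eq hT hU i ht hy
  have hm : T ×ˢ U ∈ 𝓝 (t, y) := hTU.mem_nhds ⟨ht, hy⟩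
  have c1 : (fun p : ℝ × Coord n => RicciFlow.pderiv i (f p.1) p.2) =ᶠ[𝓝 (t, y)] fun p =>
      fderiv ℝ (fun p : ℝ × Coord n => f p.1 p.2) p (0, EuclideanSpace.single i 1) :=
    Filter.eventuallyEq_of_mem hm fun p hp => hf.pderiv_eq hT hU i hp.1 hp.2
  have c2 : (fun p : ℝ × Coord n => RicciFlow.tderiv f p.1 p.2) =ᶠ[𝓝 (t, y)] fun p =>
      fderiv ℝ (fun p : ℝ × Coord n => f p.1 p.2) p (1, 0) :=
    Filter.eventuallyEq_of_mem hm fun p hp => (hf.tderiv_eq hT hU hp.1 hp.2).deriv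
  rw [e1, e2, c1.fderiv_eq, c2.fderiv_eq]
  exact fderiv_apply_comm hf hTU ⟨ht, hy⟩ _ _

end

end Time

/-! ### The Levi-Civita connection and its curvature -/

section Connection

/-- The connection matrix `A_i = (Γ^k_{ij})_{k,j}` in the direction `∂_i`. -/
noncomputable def conn (G : Coord n → Mat n) (i : Fin n) (y : Coord n) : Mat n :=
  Matrix.of fun k j => christoffel G k i j y

/-- The curvature `F_{ij} = ∂_i A_j - ∂_j A_i + [A_i, A_j]` of the connection matrices. -/
noncomputable def curv (G : Coord n → Mat n) (i j : Fin n) (y : Coord n) : Mat n :=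
  mpderiv i (conn G j) y - mpderiv j (conn G i) y +
    (conn G i y * conn G j y - conn G j y * conn G i y)

/-- A smooth Riemannian metric on an open set of coordinate space, as a matrix of functions. -/
structure IsCoordMetric (G : Coord n → Mat n) (U : Set (Coord n)) : Prop where
  isOpen : IsOpen U
  smooth : SmoothMat G U
  posDef : ∀ y ∈ U, (G y).PosDef

variable {G : Coord n → Mat n} {U : Set (Coord n)} {y : Coord n}

lemma conn_apply (i k j : Fin n) : conn G i y k j = christoffel G k i j y := rfl

lemma coordRicci_eq_sum_curv (j k : Fin n) :
    coordRicci G y j k = ∑ i, curv G i j y i k := by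
  simp only [coordRicci, curv, Matrix.add_apply, Matrix.sub_apply, Matrix.mul_apply,
    Finset.sum_add_distrib, Finset.sum_sub_distrib]
  rfl

lemma coordScalar_eq_trace (hG : (G y).transpose = G y) :
    coordScalar G y = ((G y)⁻¹ * Matrix.of (coordRicci G y)).trace := by
  have hs : ((G y)⁻¹).transpose = (G y)⁻¹ := by rw [Matrix.transpose_nonsing_inv, hG]
  simp only [Matrix.trace, Matrix.diag, Matrix.mul_apply, coordScalar, Matrix.of_apply]
  rw [Finset.sum_comm]
  refine Finset.sum_congr rfl fun k _ => Finset.sum_congr rfl fun j _ => ?_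
  congr 1
  exact congrFun (congrFun hs k) j

/-- The scalar curvature depends only on the germ of the metric. -/
lemma coordScalar_congr {G' : Coord n → Mat n} (hU : IsOpen U) (h : ∀ z ∈ U, G z = G' z)
    (hy : y ∈ U) : coordScalar G y = coordScalar G' y := by
  have h1 : ∀ k i j, ∀ z ∈ U, christoffel G k i j z = christoffel G' k i j z :=
    fun k i j z hz => by
      have hp : ∀ c a b, pderiv c (fun w => G w a b) z = pderiv c (fun w => G' w a b) z :=
        fun c a b => pderiv_congr_on c hU hz fun w hw => by rw [h w hw]
      simp only [christoffel, hp, h z hz]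
  have h2 : ∀ c k i j, pderiv c (christoffel G k i j) y = pderiv c (christoffel G' k i j) y :=
    fun c k i j => pderiv_congr_on c hU hy (h1 k i j)
  simp only [coordScalar, coordRicci, h2, h y hy, h1 _ _ _ y hy]

namespace IsCoordMetric

variable (hG : IsCoordMetric G U)
include hG

lemma isUnit_det (hy : y ∈ U) : IsUnit (G y).det := (hG.posDef y hy).det_pos.ne'.isUnit

lemma transpose_eq (hy : y ∈ U) : (G y).transpose = G y := by
  simpa using (hG.posDef y hy).isHermitian.eq

lemma symm_apply (hy : y ∈ U) (i j : Fin n) : G y i j = G y j i :=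
  congrFun (congrFun (hG.transpose_eq hy) j) i

lemma pderiv_symm (hy : y ∈ U) (k i j : Fin n) :
    pderiv k (fun z => G z i j) y = pderiv k (fun z => G z j i) y :=
  pderiv_congr_on k hG.isOpen hy fun _ hz => hG.symm_apply hz i j

lemma smooth_inv : SmoothMat (fun z => (G z)⁻¹) U :=
  hG.smooth.inv fun _ hz => (hG.isUnit_det hz).ne_zero

lemma smooth_conn (i : Fin n) : SmoothMat (conn G i) U := fun k j => by
  simp only [conn_apply]
  refine contDiffOn_const.mul (ContDiffOn.sum fun l _ => (hG.smooth_inv k l).mul ?_)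
  exact ((smooth_pderiv i (hG.smooth j l) hG.isOpen).add
    (smooth_pderiv j (hG.smooth i l) hG.isOpen)).sub (smooth_pderiv l (hG.smooth i j) hG.isOpen)

lemma smooth_curv (i j : Fin n) : SmoothMat (curv G i j) U :=
  (((hG.smooth_conn j).mpderiv i hG.isOpen).sub ((hG.smooth_conn i).mpderiv j hG.isOpen)).add
    (((hG.smooth_conn i).mul (hG.smooth_conn j)).sub ((hG.smooth_conn j).mul (hG.smooth_conn i)))

lemma smooth_ricci : SmoothMat (fun z => Matrix.of (coordRicci G z)) U := fun j k => by
  simp only [Matrix.of_apply, coordRicci_eq_sum_curv]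
  exact ContDiffOn.sum fun i _ => hG.smooth_curv i j i k

lemma pderiv_ricci (hy : y ∈ U) (k i j : Fin n) :
    pderiv k (fun z => coordRicci G z i j) y = ∑ a, mpderiv k (curv G a i) y a j := by
  simp only [coordRicci_eq_sum_curv]
  exact pderiv_sum k _ fun a _ => smooth_differentiableAt (hG.smooth_curv a i a j) hG.isOpen hy

lemma conn_symm (hy : y ∈ U) (k i j : Fin n) : conn G i y k j = conn G j y k i := by
  simp only [conn_apply, christoffel]
  congr 1
  refine Finset.sum_congr rfl fun l _ => ?_
  rw [hG.pderiv_symm hy l i j]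
  ring

/-- Lowering the index of the Christoffel symbols. -/
lemma metric_mul_conn (hy : y ∈ U) (i l j : Fin n) :
    (G y * conn G i y) l j = 1 / 2 * (pderiv i (fun z => G z j l) y +
      pderiv j (fun z => G z i l) y - pderiv l (fun z => G z i j) y) := by
  have h : conn G i y = (G y)⁻¹ * Matrix.of fun l j => 1 / 2 * (pderiv i (fun z => G z j l) y +
      pderiv j (fun z => G z i l) y - pderiv l (fun z => G z i j) y) := by
    ext k j
    simp only [conn_apply, christoffel, Matrix.mul_apply, Matrix.of_apply, Finset.mul_sum]
    exact Finset.sum_congr rfl fun l _ => by ring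
  rw [h, Matrix.mul_nonsing_inv_cancel_left _ _ (hG.isUnit_det hy)]
  rfl

/-- The Levi-Civita connection is compatible with the metric. -/
lemma conn_compat (hy : y ∈ U) (i : Fin n) :
    mpderiv i G y = (conn G i y).transpose * G y + G y * conn G i y := by
  have h : (conn G i y).transpose * G y = (G y * conn G i y).transpose := by
    rw [Matrix.transpose_mul, hG.transpose_eq hy]
  rw [h]
  ext a b
  simp only [Matrix.add_apply, Matrix.transpose_apply, hG.metric_mul_conn hy, mpderiv_apply]
  rw [hG.pderiv_symm hy i b a]
  ring

/-- The Levi-Civita connection is the only torsion-free connection compatible with the metric. -/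
lemma conn_unique (hy : y ∈ U) {B : Fin n → Mat n} (hB : ∀ i j k, B i k j = B j k i)
    (h : ∀ i, mpderiv i G y = (B i).transpose * G y + G y * B i) (i : Fin n) :
    B i = conn G i y := by
  have hs : ∀ i, (B i).transpose * G y = (G y * B i).transpose := fun i => by
    rw [Matrix.transpose_mul, hG.transpose_eq hy]
  have hL : ∀ i j l, (G y * B i) l j = (G y * B j) l i := fun i j l => by
    simp only [Matrix.mul_apply]
    exact Finset.sum_congr rfl fun k _ => by rw [hB]
  have hd : ∀ i a b, pderiv i (fun z => G z a b) y = (G y * B i) b a + (G y * B i) a b :=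
    fun i a b => by
      have := congrFun (congrFun (h i) a) b
      rw [hs] at this
      exact this
  have hGB : G y * B i = G y * conn G i y := by
    ext l j
    rw [hG.metric_mul_conn hy, hd, hd, hd]
    linarith [hL i j l, hL i l j, hL j l i]
  have := congrArg ((G y)⁻¹ * ·) hGB
  simpa only [Matrix.nonsing_inv_mul_cancel_left _ _ (hG.isUnit_det hy)] using this

/-- The curvature is skew-adjoint with respect to the metric: this is the symmetry
`∂_i∂_j G = ∂_j∂_i G`, with both sides expanded by metric compatibility. -/
lemma curv_skew (hy : y ∈ U) (i j : Fin n) :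
    G y * curv G i j y + (curv G i j y).transpose * G y = 0 := by
  have hd : ∀ i j, mpderiv i (mpderiv j G) y =
      (mpderiv i (conn G j) y).transpose * G y +
        (conn G j y).transpose * ((conn G i y).transpose * G y + G y * conn G i y) +
      (((conn G i y).transpose * G y + G y * conn G i y) * conn G j y +
        G y * mpderiv i (conn G j) y) := fun i j => by
    rw [mpderiv_congr i hG.isOpen hy fun z hz => hG.conn_compat hz j,
      mpderiv_add i ((hG.smooth_conn j).transpose.mul hG.smooth)
        (hG.smooth.mul (hG.smooth_conn j)) hG.isOpen hy,
      mpderiv_mul i (hG.smooth_conn j).transpose hG.smooth hG.isOpen hy,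
      mpderiv_mul i hG.smooth (hG.smooth_conn j) hG.isOpen hy, mpderiv_transpose,
      hG.conn_compat hy i]
  have h := mpderiv_comm i j hG.smooth hG.isOpen hy
  rw [hd, hd, ← sub_eq_zero] at h
  rw [← h]
  simp only [curv, Matrix.transpose_add, Matrix.transpose_sub, Matrix.transpose_mul]
  noncomm_ring

end IsCoordMetric

end Connection

/-! ### Changes of coordinates -/

section Pullback

/-- The Jacobian matrix of `φ`. -/
noncomputable def jac (φ : Coord n → Coord n) (y : Coord n) : Mat n :=
  Matrix.of fun a i => pderiv i (fun z => φ z a) y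

/-- The pullback `Jᵀ (G ∘ φ) J` of a bilinear form along `φ`. -/
noncomputable def pull (φ : Coord n → Coord n) (G : Coord n → Mat n) (y : Coord n) : Mat n :=
  (jac φ y).transpose * G (φ y) * jac φ y

/-- A smooth local diffeomorphism `φ` from the open set `V` into `U`. -/
structure IsCoordChange (φ : Coord n → Coord n) (V U : Set (Coord n)) : Prop where
  isOpen : IsOpen V
  mapsTo : ∀ y ∈ V, φ y ∈ U
  smooth : ContDiffOn ℝ ∞ φ V
  det_ne : ∀ y ∈ V, (jac φ y).det ≠ 0

variable {φ : Coord n → Coord n} {G : Coord n → Mat n} {U V : Set (Coord n)} {y : Coord n}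

namespace IsCoordChange

variable (hφ : IsCoordChange φ V U)
include hφ

lemma smooth_coord (a : Fin n) : ContDiffOn ℝ ∞ (fun z => φ z a) V :=
  (EuclideanSpace.proj a : Coord n →L[ℝ] ℝ).contDiff.comp_contDiffOn hφ.smooth

lemma smooth_jac : SmoothMat (jac φ) V :=
  fun a i => smooth_pderiv i (hφ.smooth_coord a) hφ.isOpen

lemma differentiableAt (hy : y ∈ V) : DifferentiableAt ℝ φ y :=
  (hφ.smooth.contDiffAt (hφ.isOpen.mem_nhds hy)).differentiableAt (by simp)

lemma smooth_comp {A : Coord n → Mat n} (hA : SmoothMat A U) : SmoothMat (fun z => A (φ z)) V :=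
  fun a b => (hA a b).comp hφ.smooth hφ.mapsTo

lemma mpderiv_comp (hU : IsOpen U) {A : Coord n → Mat n} (hA : SmoothMat A U) (hy : y ∈ V)
    (i : Fin n) :
    mpderiv i (fun z => A (φ z)) y = ∑ a, jac φ y a i • mpderiv a A (φ y) := by
  ext p q
  simp only [mpderiv_apply, Matrix.sum_apply, Matrix.smul_apply, smul_eq_mul]
  exact pderiv_comp i (smooth_differentiableAt (hA p q) hU (hφ.mapsTo y hy))
    (hφ.differentiableAt hy)

lemma pderiv_jac_symm (hy : y ∈ V) (a i j : Fin n) :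
    pderiv i (fun z => jac φ z a j) y = pderiv j (fun z => jac φ z a i) y :=
  pderiv_comm i j (hφ.smooth_coord a) hφ.isOpen hy

lemma isCoordMetric_pull (hG : IsCoordMetric G U) : IsCoordMetric (pull φ G) V where
  isOpen := hφ.isOpen
  smooth := (hφ.smooth_jac.transpose.mul (hφ.smooth_comp hG.smooth)).mul hφ.smooth_jac
  posDef := fun y hy => by
    have hinj : Function.Injective (jac φ y).mulVec :=
      Matrix.mulVec_injective_iff_isUnit.2
        ((Matrix.isUnit_iff_isUnit_det _).2 (hφ.det_ne y hy).isUnit)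
    simpa [pull] using (hG.posDef _ (hφ.mapsTo y hy)).conjTranspose_mul_mul_same hinj

/-- The transformation law `∂_i∂_j φ^a + Γ^a_{bc} ∂_iφ^b ∂_jφ^c = ∂_kφ^a Γ'^k_{ij}` of the
Christoffel symbols. The right hand side solved for `Γ'` is torsion-free and compatible with the
pulled back metric, so it is the Levi-Civita connection. -/
lemma jac_mul_conn (hG : IsCoordMetric G U) (hy : y ∈ V) (i : Fin n) :
    jac φ y * conn (pull φ G) i y =
      mpderiv i (jac φ) y + (∑ a, jac φ y a i • conn G a (φ y)) * jac φ y := by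
  have hJ : IsUnit (jac φ y).det := (hφ.det_ne y hy).isUnit
  set S : Fin n → Mat n := fun i => ∑ a, jac φ y a i • conn G a (φ y) with hS
  have key : ∀ i, (jac φ y)⁻¹ * (mpderiv i (jac φ) y + S i * jac φ y) =
      conn (pull φ G) i y := by
    refine (hφ.isCoordMetric_pull hG).conn_unique hy (fun i j k => ?_) fun i => ?_
    · simp only [Matrix.mul_apply (M := (jac φ y)⁻¹)]
      refine Finset.sum_congr rfl fun a _ => ?_
      congr 1
      rw [Matrix.add_apply, Matrix.add_apply, mpderiv_apply, mpderiv_apply,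
        hφ.pderiv_jac_symm hy]
      congr 1
      simp only [hS, Matrix.mul_apply, Matrix.sum_apply, Matrix.smul_apply, smul_eq_mul,
        Finset.sum_mul]
      rw [Finset.sum_comm]
      refine Finset.sum_congr rfl fun b _ => Finset.sum_congr rfl fun c _ => ?_
      rw [hG.conn_symm (hφ.mapsTo y hy)]
      ring
    · have hc := hφ.mpderiv_comp hG.isOpen hG.smooth hy i
      have hc' : mpderiv i (fun z => G (φ z)) y =
          (S i).transpose * G (φ y) + G (φ y) * S i := by
        rw [hc]
        simp only [hS, Matrix.transpose_sum, Matrix.sum_mul, Matrix.mul_sum, Matrix.transpose_smul,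
          ← Finset.sum_add_distrib]
        refine Finset.sum_congr rfl fun a _ => ?_
        rw [hG.conn_compat (hφ.mapsTo y hy) a]
        simp [smul_add]
      have hp : mpderiv i (pull φ G) y =
          ((mpderiv i (jac φ) y).transpose * G (φ y) + (jac φ y).transpose *
            ((S i).transpose * G (φ y) + G (φ y) * S i)) * jac φ y +
          (jac φ y).transpose * G (φ y) * mpderiv i (jac φ) y := by
        have h1 := mpderiv_mul i (hφ.smooth_jac.transpose.mul (hφ.smooth_comp hG.smooth))
          hφ.smooth_jac hφ.isOpen hy
        rw [mpderiv_mul i hφ.smooth_jac.transpose (hφ.smooth_comp hG.smooth) hφ.isOpen hy, hc',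
          mpderiv_transpose] at h1
        exact h1
      have e1 : ∀ X : Mat n, pull φ G y * ((jac φ y)⁻¹ * X) =
          (jac φ y).transpose * G (φ y) * X := fun X => by
        rw [pull, Matrix.mul_assoc _ (jac φ y), Matrix.mul_nonsing_inv_cancel_left _ _ hJ]
      have e2 : ∀ X : Mat n, ((jac φ y)⁻¹ * X).transpose * pull φ G y =
          X.transpose * (G (φ y) * jac φ y) := fun X => by
        have := congrArg Matrix.transpose (e1 X)
        have ht := (hφ.isCoordMetric_pull hG).transpose_eq hy
        rw [Matrix.transpose_mul, ht] at this
        rw [this, Matrix.transpose_mul, Matrix.transpose_mul, Matrix.transpose_transpose,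
          hG.transpose_eq (hφ.mapsTo y hy)]
      rw [hp, e1, e2]
      simp only [Matrix.transpose_add, Matrix.transpose_mul]
      noncomm_ring
  rw [← key, Matrix.mul_nonsing_inv_cancel_left _ _ hJ]

/-- The curvature is a tensor: `J F'_{ij} = ∂_iφ^a ∂_jφ^b F_{ab} J`. -/
lemma jac_mul_curv (hG : IsCoordMetric G U) (hy : y ∈ V) (i j : Fin n) :
    jac φ y * curv (pull φ G) i j y =
      (∑ a, ∑ b, (jac φ y a i * jac φ y b j) • curv G a b (φ y)) * jac φ y := by
  have hG' := hφ.isCoordMetric_pull hG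
  have sS : ∀ i, SmoothMat (fun z => ∑ a, jac φ z a i • conn G a (φ z)) V := fun i =>
    SmoothMat.sum_smul (fun a => hφ.smooth_jac a i) fun a => hφ.smooth_comp (hG.smooth_conn a)
  set S : Fin n → Coord n → Mat n := fun i z => ∑ a, jac φ z a i • conn G a (φ z) with hS
  have hA : ∀ i, ∀ z ∈ V, jac φ z * conn (pull φ G) i z = mpderiv i (jac φ) z + S i z * jac φ z :=
    fun i z hz => hφ.jac_mul_conn hG hz i
  -- Differentiate the transformation law of the connection; in the part antisymmetric in `i, k` the
  -- third derivatives of `φ` cancel.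
  have hd : ∀ k i, mpderiv k (jac φ) y * conn (pull φ G) i y +
      jac φ y * mpderiv k (conn (pull φ G) i) y = mpderiv k (mpderiv i (jac φ)) y +
        (mpderiv k (S i) y * jac φ y + S i y * mpderiv k (jac φ) y) := fun k i => by
    rw [← mpderiv_mul k hφ.smooth_jac (hG'.smooth_conn i) hφ.isOpen hy,
      mpderiv_congr k hφ.isOpen hy (hA i),
      mpderiv_add k (hφ.smooth_jac.mpderiv i hφ.isOpen) ((sS i).mul hφ.smooth_jac) hφ.isOpen hy,
      mpderiv_mul k (sS i) hφ.smooth_jac hφ.isOpen hy]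
  have hdS : ∀ k i, mpderiv k (S i) y = ∑ a, pderiv k (fun z => jac φ z a i) y • conn G a (φ y) +
      ∑ a, ∑ b, (jac φ y b k * jac φ y a i) • mpderiv b (conn G a) (φ y) := fun k i => by
    rw [hS, mpderiv_sum_smul k (fun a => hφ.smooth_jac a i)
      (fun a => hφ.smooth_comp (hG.smooth_conn a)) hφ.isOpen hy, Finset.sum_add_distrib]
    congr 1
    refine Finset.sum_congr rfl fun a _ => ?_
    rw [hφ.mpderiv_comp hG.isOpen (hG.smooth_conn a) hy, Finset.smul_sum]
    exact Finset.sum_congr rfl fun b _ => by rw [smul_smul, mul_comm]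
  have hF : ∑ a, ∑ b, (jac φ y a i * jac φ y b j) • curv G a b (φ y) =
      mpderiv i (S j) y - mpderiv j (S i) y + (S i y * S j y - S j y * S i y) := by
    have h1 : ∀ a, pderiv i (fun z => jac φ z a j) y = pderiv j (fun z => jac φ z a i) y :=
      fun a => hφ.pderiv_jac_symm hy a i j
    have h2 : ∀ i j, S i y * S j y = ∑ a, ∑ b, (jac φ y a i * jac φ y b j) •
        (conn G a (φ y) * conn G b (φ y)) := fun i j => by
      simp only [hS, Matrix.sum_mul, Matrix.mul_sum, Matrix.smul_mul, Matrix.mul_smul, Finset.smul_sum,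
        smul_smul]
      rw [Finset.sum_comm]
      refine Finset.sum_congr rfl fun a _ => Finset.sum_congr rfl fun b _ => ?_
      rw [mul_comm]
    rw [hdS, hdS, h2, h2]
    simp only [h1, curv, smul_add, smul_sub, Finset.sum_add_distrib, Finset.sum_sub_distrib]
    have c1 : ∑ a, ∑ b, (jac φ y a i * jac φ y b j) • mpderiv a (conn G b) (φ y) =
        ∑ a, ∑ b, (jac φ y b i * jac φ y a j) • mpderiv b (conn G a) (φ y) := Finset.sum_comm
    have c2 : ∑ a, ∑ b, (jac φ y a i * jac φ y b j) • mpderiv b (conn G a) (φ y) =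
        ∑ a, ∑ b, (jac φ y b j * jac φ y a i) • mpderiv b (conn G a) (φ y) := by
      simp only [mul_comm]
    have c3 : ∑ a, ∑ b, (jac φ y a i * jac φ y b j) • (conn G b (φ y) * conn G a (φ y)) =
        ∑ a, ∑ b, (jac φ y a j * jac φ y b i) • (conn G a (φ y) * conn G b (φ y)) := by
      rw [Finset.sum_comm]
      simp only [mul_comm]
    rw [c1, c2, c3]
    abel
  have hc := mpderiv_comm i j hφ.smooth_jac hφ.isOpen hy
  have hJ : ∀ i, mpderiv i (jac φ) y = jac φ y * conn (pull φ G) i y - S i y * jac φ y :=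
    fun i => by rw [hA i y hy]; abel
  have d1 := hd i j
  have d2 := hd j i
  have e1 : jac φ y * mpderiv i (conn (pull φ G) j) y = mpderiv i (mpderiv j (jac φ)) y +
        (mpderiv i (S j) y * jac φ y + S j y * mpderiv i (jac φ) y) -
        mpderiv i (jac φ) y * conn (pull φ G) j y := by rw [← d1]; abel
  have e2 : jac φ y * mpderiv j (conn (pull φ G) i) y = mpderiv i (mpderiv j (jac φ)) y +
        (mpderiv j (S i) y * jac φ y + S i y * mpderiv j (jac φ) y) -
        mpderiv j (jac φ) y * conn (pull φ G) i y := by rw [hc, ← d2]; abel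
  rw [hF, curv, mul_add, mul_sub, e1, e2, hJ, hJ]
  noncomm_ring

/-- The Ricci tensor is a tensor. -/
lemma ricci_pull (hG : IsCoordMetric G U) (hy : y ∈ V) :
    Matrix.of (coordRicci (pull φ G) y) =
      (jac φ y).transpose * Matrix.of (coordRicci G (φ y)) * jac φ y := by
  have hJ : IsUnit (jac φ y).det := (hφ.det_ne y hy).isUnit
  have hF : ∀ i j, curv (pull φ G) i j y = (jac φ y)⁻¹ *
      (∑ a, ∑ b, (jac φ y a i * jac φ y b j) • curv G a b (φ y)) * jac φ y := fun i j => by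
    rw [Matrix.mul_assoc, ← hφ.jac_mul_curv hG hy, Matrix.nonsing_inv_mul_cancel_left _ _ hJ]
  have hid : ∀ a p, ∑ i, jac φ y a i * (jac φ y)⁻¹ i p = if a = p then 1 else 0 := fun a p => by
    rw [← Matrix.mul_apply, Matrix.mul_nonsing_inv _ hJ, Matrix.one_apply]
  have hs : ∀ f : Fin n → Fin n → Fin n → Fin n → ℝ,
      ∑ i, ∑ a, ∑ b, ∑ p, f i a b p = ∑ b, ∑ a, ∑ p, ∑ i, f i a b p := fun f => by
    rw [Finset.sum_comm]
    simp only [Finset.sum_comm (f := fun i b => ∑ p, f i _ b p)]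
    rw [Finset.sum_comm]
    simp only [Finset.sum_comm (f := fun i p => f i _ _ p)]
  ext j k
  simp only [Matrix.of_apply, coordRicci_eq_sum_curv, hF]
  -- The contraction pairs `J` with `J⁻¹`, which leaves `δ_{ap}`.
  calc ∑ i, ((jac φ y)⁻¹ * (∑ a, ∑ b, (jac φ y a i * jac φ y b j) • curv G a b (φ y)) *
        jac φ y) i k
      = ∑ c, ∑ b, ∑ a, ∑ p, (∑ i, jac φ y a i * (jac φ y)⁻¹ i p) *
          (jac φ y b j * curv G a b (φ y) p c * jac φ y c k) := by
        simp only [Matrix.mul_apply, Matrix.sum_apply, Matrix.smul_apply, smul_eq_mul,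
          Finset.sum_mul, Finset.mul_sum]
        rw [Finset.sum_comm]
        refine Finset.sum_congr rfl fun c _ => ?_
        rw [hs]
        refine Finset.sum_congr rfl fun b _ => Finset.sum_congr rfl fun a _ =>
          Finset.sum_congr rfl fun p _ => Finset.sum_congr rfl fun i _ => ?_
        ring
    _ = ∑ c, ∑ b, ∑ a, jac φ y b j * curv G a b (φ y) a c * jac φ y c k := by
        simp [hid]
    _ = _ := by
        simp only [Matrix.mul_apply, Matrix.of_apply, Matrix.transpose_apply,
          coordRicci_eq_sum_curv, Finset.sum_mul, Finset.mul_sum]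

/-- The scalar curvature is a scalar. -/
lemma scalar_pull (hG : IsCoordMetric G U) (hy : y ∈ V) :
    coordScalar (pull φ G) y = coordScalar G (φ y) := by
  have hJ : IsUnit (jac φ y).det := (hφ.det_ne y hy).isUnit
  have hJt : IsUnit (jac φ y).transpose.det := by rwa [Matrix.det_transpose]
  rw [coordScalar_eq_trace ((hφ.isCoordMetric_pull hG).transpose_eq hy),
    coordScalar_eq_trace (hG.transpose_eq (hφ.mapsTo y hy)), hφ.ricci_pull hG hy, pull,
    Matrix.mul_inv_rev, Matrix.mul_inv_rev]
  rw [show ∀ a b c d e : Mat n, a * (b * c) * (d * e * jac φ y) =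
    a * (b * (c * d) * e * jac φ y) by intros; noncomm_ring]
  rw [Matrix.nonsing_inv_mul _ hJt, mul_one, Matrix.trace_mul_comm, Matrix.mul_assoc,
    Matrix.mul_nonsing_inv _ hJ, mul_one]

end IsCoordChange

end Pullback

/-! ### The contracted second Bianchi identity -/

section Bianchi

variable {G : Coord n → Mat n} {U : Set (Coord n)} {p : Coord n}

/-- `p` is the centre of normal coordinates of `G`, up to first order: the metric is the identity
there and the Christoffel symbols vanish. -/
structure IsNormalAt (G : Coord n → Mat n) (p : Coord n) : Prop where
  eq_one : G p = 1
  conn_eq_zero : ∀ i, conn G i p = 0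

namespace IsCoordMetric

variable (hG : IsCoordMetric G U) (hp : p ∈ U) (h : IsNormalAt G p)
include hG hp h

lemma mpderiv_eq_zero (i : Fin n) : mpderiv i G p = 0 := by
  rw [hG.conn_compat hp, h.conn_eq_zero]
  simp

lemma mpderiv_inv_eq_zero (i : Fin n) : mpderiv i (fun z => (G z)⁻¹) p = 0 := by
  have h1 := mpderiv_mul i hG.smooth hG.smooth_inv hG.isOpen hp
  rw [mpderiv_congr (B := fun _ => 1) i hG.isOpen hp
    fun z hz => Matrix.mul_nonsing_inv _ (hG.isUnit_det hz), mpderiv_const,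
    hG.mpderiv_eq_zero hp h, h.eq_one] at h1
  simpa using h1.symm

lemma mpderiv_curv (k i j : Fin n) : mpderiv k (curv G i j) p =
    mpderiv k (mpderiv i (conn G j)) p - mpderiv k (mpderiv j (conn G i)) p := by
  have s := hG.smooth_conn
  have o := hG.isOpen
  have h1 := mpderiv_add k (((s j).mpderiv i o).sub ((s i).mpderiv j o))
    (((s i).mul (s j)).sub ((s j).mul (s i))) o hp
  rw [mpderiv_sub k ((s j).mpderiv i o) ((s i).mpderiv j o) o hp,
    mpderiv_sub k ((s i).mul (s j)) ((s j).mul (s i)) o hp,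
    mpderiv_mul k (s i) (s j) o hp, mpderiv_mul k (s j) (s i) o hp,
    h.conn_eq_zero, h.conn_eq_zero] at h1
  refine h1.trans ?_
  simp

/-- The second Bianchi identity at the centre of normal coordinates. -/
lemma bianchi (i j k : Fin n) : mpderiv k (curv G i j) p + mpderiv i (curv G j k) p +
    mpderiv j (curv G k i) p = 0 := by
  have s := hG.smooth_conn
  have o := hG.isOpen
  simp only [hG.mpderiv_curv hp h]
  rw [mpderiv_comm k i (s j) o hp, mpderiv_comm k j (s i) o hp, mpderiv_comm i j (s k) o hp]
  abel

lemma mpderiv_curv_skew (k i j a b : Fin n) :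
    mpderiv k (curv G i j) p a b = - mpderiv k (curv G i j) p b a := by
  have s := hG.smooth_curv i j
  have o := hG.isOpen
  have h1 := mpderiv_add k (hG.smooth.mul s) (s.transpose.mul hG.smooth) o hp
  rw [mpderiv_congr (B := fun _ => 0) k o hp fun z hz => hG.curv_skew hz i j, mpderiv_const,
    mpderiv_mul k hG.smooth s o hp, mpderiv_mul k s.transpose hG.smooth o hp,
    hG.mpderiv_eq_zero hp h, h.eq_one, mpderiv_transpose] at h1
  have h2 := congrFun (congrFun h1 a) b
  simp at h2
  linarith

lemma curv_antisymm (k i j a b : Fin n) :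
    mpderiv k (curv G i j) p a b = - mpderiv k (curv G j i) p a b := by
  rw [hG.mpderiv_curv hp h, hG.mpderiv_curv hp h]
  simp

lemma pderiv_scalar (k : Fin n) :
    pderiv k (coordScalar G) p = ∑ i, pderiv k (fun z => coordRicci G z i i) p := by
  have h1 : ∀ i j, DifferentiableAt ℝ (fun z => (G z)⁻¹ i j) p := fun i j =>
    smooth_differentiableAt (hG.smooth_inv i j) hG.isOpen hp
  have h2 : ∀ i j, DifferentiableAt ℝ (fun z => coordRicci G z i j) p := fun i j =>
    smooth_differentiableAt (hG.smooth_ricci i j) hG.isOpen hp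
  have h3 : ∀ i j, pderiv k (fun z => (G z)⁻¹ i j) p = 0 := fun i j =>
    congrFun (congrFun (hG.mpderiv_inv_eq_zero hp h k) i) j
  have h4 : pderiv k (coordScalar G) p =
      ∑ i, ∑ j, pderiv k (fun z => (G z)⁻¹ i j * coordRicci G z i j) p := by
    unfold coordScalar
    rw [pderiv_sum k _ fun i _ => DifferentiableAt.fun_sum fun j _ => (h1 i j).fun_mul (h2 i j)]
    exact Finset.sum_congr rfl fun i _ => pderiv_sum k _ fun j _ => (h1 i j).fun_mul (h2 i j)
  rw [h4]
  refine Finset.sum_congr rfl fun i _ => ?_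
  simp only [pderiv_mul k (h1 _ _) (h2 _ _), h3, h.eq_one, inv_one, Matrix.one_apply]
  simp

/-- The contracted second Bianchi identity `∇_k R = 2 ∇^i R_{ki}` at the centre of normal
coordinates. -/
lemma contracted_bianchi (k : Fin n) :
    pderiv k (coordScalar G) p = 2 * ∑ i, pderiv i (fun z => coordRicci G z k i) p := by
  -- Contract the Bianchi identity for `F_{ij}`, `F_{jk}`, `F_{ki}` over the entry `(i, j)`.
  have hb : ∑ j, ∑ i, (mpderiv k (curv G i j) p i j + mpderiv i (curv G j k) p i j +
      mpderiv j (curv G k i) p i j) = 0 := by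
    refine Finset.sum_eq_zero fun j _ => Finset.sum_eq_zero fun i _ => ?_
    exact congrFun (congrFun (hG.bianchi hp h i j k) i) j
  rw [hG.pderiv_scalar hp h]
  simp only [hG.pderiv_ricci hp]
  simp only [Finset.sum_add_distrib] at hb
  have h1 : ∑ j, ∑ i, mpderiv i (curv G j k) p i j =
      - ∑ i, ∑ a, mpderiv i (curv G a k) p a i := by
    rw [Finset.sum_comm, ← Finset.sum_neg_distrib]
    refine Finset.sum_congr rfl fun i _ => ?_
    rw [← Finset.sum_neg_distrib]
    exact Finset.sum_congr rfl fun a _ => hG.mpderiv_curv_skew hp h _ _ _ _ _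
  have h2 : ∑ j, ∑ i, mpderiv j (curv G k i) p i j =
      - ∑ i, ∑ a, mpderiv i (curv G a k) p a i := by
    rw [← Finset.sum_neg_distrib]
    refine Finset.sum_congr rfl fun i _ => ?_
    rw [← Finset.sum_neg_distrib]
    exact Finset.sum_congr rfl fun a _ => hG.curv_antisymm hp h _ _ _ _ _
  linarith

end IsCoordMetric

end Bianchi

/-! ### Normal coordinates -/

section Normal

open scoped MatrixOrder in
lemma exists_transpose_mul_mul_eq_one {M : Mat n} (hM : M.PosDef) :
    ∃ L : Mat n, L.det ≠ 0 ∧ L.transpose * M * L = 1 := by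
  obtain ⟨B, hB⟩ := CStarAlgebra.nonneg_iff_eq_star_mul_self.mp
    (Matrix.nonneg_iff_posSemidef.2 hM.posSemidef)
  have hB' : M = B.transpose * B := by
    rw [hB, Matrix.star_eq_conjTranspose, Matrix.conjTranspose_eq_transpose_of_trivial]
  have hd : IsUnit B.det := by
    have h := hM.det_pos.ne'
    rw [hB', Matrix.det_mul] at h
    exact (right_ne_zero_of_mul h).isUnit
  have hdt : IsUnit B.transpose.det := by rwa [Matrix.det_transpose]
  refine ⟨B⁻¹, ?_, ?_⟩
  · exact (Matrix.isUnit_nonsing_inv_det _ hd).ne_zero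
  · rw [hB', Matrix.transpose_nonsing_inv, Matrix.nonsing_inv_mul_cancel_left _ _ hdt,
      Matrix.mul_nonsing_inv _ hd]

/-- The polynomial map `y ↦ q + L y - (1/2) Q(y, y)`. -/
noncomputable def quadMap (q : Coord n) (L : Mat n) (Q : Fin n → Mat n) (y : Coord n) : Coord n :=
  WithLp.toLp 2 fun a => q a + ∑ i, L a i * y i - 1 / 2 * ∑ i, ∑ j, Q a i j * (y i * y j)

variable {q : Coord n} {L : Mat n} {Q : Fin n → Mat n}

lemma contDiff_quadMap : ContDiff ℝ ∞ (quadMap q L Q) := by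
  rw [contDiff_euclidean]
  intro a
  simp only [quadMap]
  fun_prop

lemma jac_quadMap (hQ : ∀ a i j, Q a i j = Q a j i) (y : Coord n) (a i : Fin n) :
    jac (quadMap q L Q) y a i = L a i - ∑ j, Q a i j * y j := by
  have dc : ∀ i, DifferentiableAt ℝ (fun z : Coord n => z i) y := fun i => by fun_prop
  have h1 : pderiv i (fun z : Coord n => ∑ j, L a j * z j) y = L a i := by
    rw [pderiv_sum i _ fun j _ => (dc j).const_mul _]
    simp [pderiv_const_mul i _ (dc _), pderiv_coord]
  have h2 : pderiv i (fun z : Coord n => ∑ j, ∑ k, Q a j k * (z j * z k)) y =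
      2 * ∑ j, Q a i j * y j := by
    have dt : ∀ j k, DifferentiableAt ℝ (fun z : Coord n => Q a j k * (z j * z k)) y :=
      fun j k => by fun_prop
    have pt : ∀ j k, pderiv i (fun z : Coord n => Q a j k * (z j * z k)) y =
        Q a j k * ((if j = i then 1 else 0) * y k + y j * (if k = i then 1 else 0)) :=
      fun j k => by
        rw [pderiv_const_mul i _ ((dc j).fun_mul (dc k)), pderiv_mul i (dc j) (dc k),
          pderiv_coord, pderiv_coord]
    rw [pderiv_sum i _ fun j _ => DifferentiableAt.fun_sum fun k _ => dt j k]
    simp only [pderiv_sum i _ fun k _ => dt _ k, pt, mul_add, Finset.sum_add_distrib]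
    simp only [ite_mul, mul_ite, one_mul, mul_one, zero_mul, mul_zero, Finset.sum_ite_irrel,
      Finset.sum_const_zero, Finset.sum_ite_eq', Finset.mem_univ, if_true]
    rw [two_mul]
    congr 1
    exact Finset.sum_congr rfl fun j _ => by rw [hQ]
  have d1 : DifferentiableAt ℝ (fun z : Coord n => ∑ j, L a j * z j) y := by fun_prop
  have d2 : DifferentiableAt ℝ (fun z : Coord n => ∑ j, ∑ k, Q a j k * (z j * z k)) y := by
    fun_prop
  have h3 : jac (quadMap q L Q) y a i = pderiv i (fun z : Coord n => (q a + ∑ j, L a j * z j) -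
      1 / 2 * ∑ j, ∑ k, Q a j k * (z j * z k)) y := rfl
  rw [h3, pderiv_sub i (d1.const_add _) (d2.const_mul _), pderiv_const_mul i _ d2, h2,
    pderiv_add i (differentiableAt_const _) d1, pderiv_const, h1]
  ring

lemma mpderiv_jac_quadMap (hQ : ∀ a i j, Q a i j = Q a j i) (y : Coord n) (k a i : Fin n) :
    mpderiv k (jac (quadMap q L Q)) y a i = - Q a k i := by
  have dc : ∀ i, DifferentiableAt ℝ (fun z : Coord n => z i) y := fun i => by fun_prop
  have d1 : DifferentiableAt ℝ (fun z : Coord n => ∑ j, Q a i j * z j) y := by fun_prop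
  simp only [mpderiv_apply, jac_quadMap hQ]
  rw [pderiv_sub k (differentiableAt_const _) d1, pderiv_const,
    pderiv_sum k _ fun j _ => (dc j).const_mul _]
  simp [pderiv_const_mul k _ (dc _), pderiv_coord, hQ a k i]

/-- Every point is the centre of normal coordinates: take `φ(y) = q + L y - (1/2) Γ(L y, L y)`,
where the columns of `L` are orthonormal for the metric at `q`. -/
lemma IsCoordMetric.exists_normal {G : Coord n → Mat n} {U : Set (Coord n)}
    (hG : IsCoordMetric G U) (hq : q ∈ U) :
    ∃ φ V, IsCoordChange φ V U ∧ (0 : Coord n) ∈ V ∧ φ 0 = q ∧ IsNormalAt (pull φ G) 0 := by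
  obtain ⟨L, hLd, hL⟩ := exists_transpose_mul_mul_eq_one (hG.posDef q hq)
  -- The columns of `L` are orthonormal at `q`, and `Q a i j = Γ^a(L e_i, L e_j)`.
  set Q : Fin n → Mat n := fun a => Matrix.of fun i j =>
    ((∑ b, L b i • conn G b q) * L) a j with hQdef
  have hQ : ∀ a i j, Q a i j = Q a j i := fun a i j => by
    simp only [hQdef, Matrix.of_apply, Matrix.mul_apply, Matrix.sum_apply, Matrix.smul_apply,
      smul_eq_mul, Finset.sum_mul]
    rw [Finset.sum_comm]
    refine Finset.sum_congr rfl fun b _ => Finset.sum_congr rfl fun c _ => ?_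
    rw [hG.conn_symm hq]
    ring
  have hc : ContDiff ℝ ∞ (quadMap q L Q) := contDiff_quadMap
  have h0 : quadMap q L Q 0 = q := by
    ext a
    simp [quadMap]
  have hJ0 : jac (quadMap q L Q) 0 = L := by
    ext a i
    simp [jac_quadMap hQ]
  have hdc : Continuous fun z => (jac (quadMap q L Q) z).det := by
    refine Continuous.matrix_det (continuous_pi fun a => continuous_pi fun i => ?_)
    simp only [jac_quadMap hQ]
    fun_prop
  set V : Set (Coord n) := quadMap q L Q ⁻¹' U ∩ {z | (jac (quadMap q L Q) z).det ≠ 0} with hV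
  have hφ : IsCoordChange (quadMap q L Q) V U :=
    { isOpen := (hG.isOpen.preimage hc.continuous).inter (isOpen_ne_fun hdc continuous_const)
      mapsTo := fun y hy => hy.1
      smooth := hc.contDiffOn
      det_ne := fun y hy => hy.2 }
  have h0V : (0 : Coord n) ∈ V := ⟨by simpa [h0] using hq, by simpa [hJ0] using hLd⟩
  refine ⟨_, V, hφ, h0V, h0, ?_, fun i => ?_⟩
  · rw [pull, h0, hJ0, hL]
  · -- At `0` the second derivative `-Q` of `φ` cancels `Γ(L ·, L ·)` in the transformation law.
    have h1 := hφ.jac_mul_conn hG h0V i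
    have h2 : mpderiv i (jac (quadMap q L Q)) 0 +
        (∑ a, jac (quadMap q L Q) 0 a i • conn G a (quadMap q L Q 0)) *
          jac (quadMap q L Q) 0 = 0 := by
      ext a j
      rw [Matrix.add_apply, mpderiv_jac_quadMap hQ, h0, hJ0]
      simp [hQdef]
    rw [h2] at h1
    have := congrArg ((jac (quadMap q L Q) 0)⁻¹ * ·) h1
    simpa only [Matrix.nonsing_inv_mul_cancel_left _ _ (hφ.det_ne 0 h0V).isUnit, mul_zero]
      using this

end Normal

/-! ### The Ricci flow in coordinates -/

section Flow

/-- A smooth solution `G` of the Ricci flow on an open set `U` of coordinate space, for times in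
the open set `T`, whose scalar curvature `r(t)` is constant in space. -/
structure IsLocalFlow (G : ℝ → Coord n → Mat n) (T : Set ℝ) (U : Set (Coord n)) (r : ℝ → ℝ) :
    Prop where
  isOpen_time : IsOpen T
  isOpen : IsOpen U
  smooth : ∀ i j, JointSmooth (fun t y => G t y i j) T U
  posDef : ∀ t ∈ T, ∀ y ∈ U, (G t y).PosDef
  flow : ∀ t ∈ T, ∀ y ∈ U, ∀ i j,
    HasDerivAt (fun s => G s y i j) (-2 * coordRicci (G t) y i j) t
  scalar : ∀ t ∈ T, ∀ y ∈ U, coordScalar (G t) y = r t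

/-- The time derivative of the connection matrix in the direction `∂_i`. -/
noncomputable def connDot (G : ℝ → Coord n → Mat n) (t : ℝ) (i : Fin n) (y : Coord n) : Mat n :=
  Matrix.of fun k j => tderiv (fun s z => conn (G s) i z k j) t y

variable {G : ℝ → Coord n → Mat n} {T : Set ℝ} {U : Set (Coord n)} {r : ℝ → ℝ} {t : ℝ}
  {y : Coord n}

namespace IsLocalFlow

variable (hG : IsLocalFlow G T U r)
include hG

lemma metric (ht : t ∈ T) : IsCoordMetric (G t) U where
  isOpen := hG.isOpen
  smooth := fun i j => (hG.smooth i j).space ht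
  posDef := hG.posDef t ht

lemma smooth_inv (i j : Fin n) : JointSmooth (fun t y => (G t y)⁻¹ i j) T U :=
  SmoothMat.inv (A := fun p : ℝ × Coord n => G p.1 p.2) (U := T ×ˢ U) hG.smooth
    (fun p hp => (hG.posDef p.1 hp.1 p.2 hp.2).det_pos.ne') i j

lemma smooth_pderiv (k i j : Fin n) :
    JointSmooth (fun t y => pderiv k (fun z => G t z i j) y) T U :=
  (hG.smooth i j).pderiv hG.isOpen_time hG.isOpen k

lemma smooth_conn (i k j : Fin n) : JointSmooth (fun t y => conn (G t) i y k j) T U := by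
  simp only [conn_apply, christoffel]
  exact (JointSmooth.sum fun l _ => (hG.smooth_inv k l).mul
    (((hG.smooth_pderiv i j l).add (hG.smooth_pderiv j i l)).sub
      (hG.smooth_pderiv l i j))).const_mul _

lemma smooth_connDot (ht : t ∈ T) (i : Fin n) : SmoothMat (connDot G t i) U := fun k j =>
  ((hG.smooth_conn i k j).tderiv hG.isOpen_time hG.isOpen).space ht

lemma hasDerivAt_conn (ht : t ∈ T) (hy : y ∈ U) (i k j : Fin n) :
    HasDerivAt (fun s => conn (G s) i y k j) (connDot G t i y k j) t :=
  (hG.smooth_conn i k j).hasDerivAt hG.isOpen_time hG.isOpen ht hy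

/-- Functions of time that agree on `T` have the same derivative at times in `T`. -/
lemma hasDerivAt_congr {f h : ℝ → ℝ} {a b : ℝ} (ht : t ∈ T) (e : ∀ s ∈ T, f s = h s)
    (hf : HasDerivAt f a t) (hh : HasDerivAt h b t) : a = b :=
  hf.unique (hh.congr_of_eventuallyEq
    (Filter.eventuallyEq_of_mem (hG.isOpen_time.mem_nhds ht) e))

lemma connDot_symm (ht : t ∈ T) (hy : y ∈ U) (i k j : Fin n) :
    connDot G t i y k j = connDot G t j y k i :=
  hG.hasDerivAt_congr ht (fun _ hs => (hG.metric hs).conn_symm hy k i j)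
    (hG.hasDerivAt_conn ht hy i k j) (hG.hasDerivAt_conn ht hy j k i)

/-- The Ricci tensor is symmetric because, under the flow, it is a multiple of `∂_t G`. -/
lemma ricci_symm (ht : t ∈ T) (hy : y ∈ U) (i j : Fin n) :
    coordRicci (G t) y i j = coordRicci (G t) y j i := by
  have := hG.hasDerivAt_congr ht (fun _ hs => (hG.metric hs).symm_apply hy i j)
    (hG.flow t ht y hy i j) (hG.flow t ht y hy j i)
  linarith

lemma pderiv_scalar (ht : t ∈ T) (hy : y ∈ U) (k : Fin n) :
    pderiv k (coordScalar (G t)) y = 0 := by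
  rw [pderiv_congr_on k hG.isOpen hy (hG.scalar t ht), pderiv_const]

/-- The Ricci flow with spatially constant scalar curvature is invariant under time-independent
changes of coordinates. -/
lemma pull {φ : Coord n → Coord n} {V : Set (Coord n)} (hφ : IsCoordChange φ V U) :
    IsLocalFlow (fun t => pull φ (G t)) T V r where
  isOpen_time := hG.isOpen_time
  isOpen := hφ.isOpen
  smooth := by
    have h1 : SmoothMat (fun p : ℝ × Coord n => jac φ p.2) (T ×ˢ V) := fun a b =>
      (hφ.smooth_jac a b).comp contDiffOn_snd fun p hp => hp.2
    have h2 : SmoothMat (fun p : ℝ × Coord n => G p.1 (φ p.2)) (T ×ˢ V) := fun a b =>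
      ContDiffOn.comp (hG.smooth a b) (f := fun p : ℝ × Coord n => (p.1, φ p.2))
        (contDiffOn_fst.prodMk (hφ.smooth.comp contDiffOn_snd fun p hp => hp.2))
        fun p hp => ⟨hp.1, hφ.mapsTo _ hp.2⟩
    exact (h1.transpose.mul h2).mul h1
  posDef := fun t ht => (hφ.isCoordMetric_pull (hG.metric ht)).posDef
  flow := fun t ht y hy i j => by
    have hR : coordRicci (RicciFlow.pull φ (G t)) y i j = _ :=
      congrFun (congrFun (hφ.ricci_pull (hG.metric ht) hy) i) j
    rw [hR]
    simp only [RicciFlow.pull, Matrix.mul_apply, Matrix.of_apply, Finset.mul_sum, Finset.sum_mul]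
    refine HasDerivAt.fun_sum fun a _ => HasDerivAt.fun_sum fun b _ => ?_
    refine (((hG.flow t ht _ (hφ.mapsTo y hy) b a).const_mul
      ((jac φ y).transpose i b)).mul_const (jac φ y a j)).congr_deriv ?_
    ring
  scalar := fun t ht y hy => by
    rw [hφ.scalar_pull (hG.metric ht) hy, hG.scalar t ht _ (hφ.mapsTo y hy)]

/-- The time derivative of the connection is a tensor. -/
lemma jac_mul_connDot {φ : Coord n → Coord n} {V : Set (Coord n)} (hφ : IsCoordChange φ V U)
    (ht : t ∈ T) (hy : y ∈ V) (i : Fin n) :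
    jac φ y * connDot (fun t => RicciFlow.pull φ (G t)) t i y =
      (∑ a, jac φ y a i • connDot G t a (φ y)) * jac φ y := by
  ext k j
  have h1 : HasDerivAt (fun s => (jac φ y * conn (RicciFlow.pull φ (G s)) i y) k j)
      ((jac φ y * connDot (fun t => RicciFlow.pull φ (G t)) t i y) k j) t := by
    simp only [Matrix.mul_apply]
    exact HasDerivAt.fun_sum fun a _ => ((hG.pull hφ).hasDerivAt_conn ht hy i a j).const_mul _
  have h2 : HasDerivAt (fun s => (mpderiv i (jac φ) y +
      (∑ a, jac φ y a i • conn (G s) a (φ y)) * jac φ y) k j)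
      (((∑ a, jac φ y a i • connDot G t a (φ y)) * jac φ y) k j) t := by
    simp only [Matrix.add_apply, Matrix.mul_apply, Matrix.sum_apply, Matrix.smul_apply,
      smul_eq_mul]
    refine HasDerivAt.const_add _ (HasDerivAt.fun_sum fun c _ => HasDerivAt.mul_const ?_ _)
    exact HasDerivAt.fun_sum fun a _ =>
      (hG.hasDerivAt_conn ht (hφ.mapsTo y hy) a k c).const_mul _
  refine hG.hasDerivAt_congr ht (fun s hs => ?_) h1 h2
  rw [hφ.jac_mul_conn (hG.metric hs) hy]

/-- At the centre of normal coordinates,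
`∂_t Γ^k_{ij} = -(∂_i R_{jk} + ∂_j R_{ik} - ∂_k R_{ij})`. -/
lemma connDot_normal (ht : t ∈ T) (hy : y ∈ U) (hN : IsNormalAt (G t) y) (i k j : Fin n) :
    connDot G t i y k j = -(pderiv i (fun z => coordRicci (G t) z j k) y +
      pderiv j (fun z => coordRicci (G t) z i k) y -
        pderiv k (fun z => coordRicci (G t) z i j) y) := by
  have hm := hG.metric ht
  have hd : ∀ c a b, HasDerivAt (fun s => pderiv c (fun z => G s z a b) y)
      (-2 * pderiv c (fun z => coordRicci (G t) z a b) y) t := fun c a b => by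
    refine ((hG.smooth_pderiv c a b).hasDerivAt hG.isOpen_time hG.isOpen ht hy).congr_deriv ?_
    have e : pderiv c (tderiv (fun s z => G s z a b) t) y =
        pderiv c (fun z => -2 * coordRicci (G t) z a b) y :=
      pderiv_congr_on c hG.isOpen hy fun z hz => (hG.flow t ht z hz a b).deriv
    rw [(hG.smooth a b).tderiv_pderiv hG.isOpen_time hG.isOpen c ht hy, e]
    exact pderiv_const_mul c _ (smooth_differentiableAt (hm.smooth_ricci a b) hG.isOpen hy)
  have h0 : ∀ c a b, pderiv c (fun z => G t z a b) y = 0 := fun c a b =>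
    congrFun (congrFun (hm.mpderiv_eq_zero hy hN c) a) b
  have h1 := (HasDerivAt.fun_sum (u := Finset.univ) fun l _ =>
    ((hG.smooth_inv k l).hasDerivAt hG.isOpen_time hG.isOpen ht hy).fun_mul
      (((hd i j l).fun_add (hd j i l)).fun_sub (hd l i j))).const_mul (1 / 2 : ℝ)
  refine (hG.hasDerivAt_conn ht hy i k j).unique (h1.congr_deriv ?_)
  simp only [h0, hN.eq_one, inv_one, Matrix.one_apply]
  simp
  ring

/-- `∂_t Γ^j_{ij} = 0`. -/
lemma trace_connDot (ht : t ∈ T) (hy : y ∈ U) (i : Fin n) : (connDot G t i y).trace = 0 := by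
  -- It suffices to compute at the centre of normal coordinates, where the trace is `-∂_i R`.
  obtain ⟨φ, V, hφ, h0, rfl, hN⟩ := (hG.metric ht).exists_normal hy
  have hm := (hG.pull hφ).metric ht
  have h1 : ∀ j, (connDot (fun t => RicciFlow.pull φ (G t)) t j 0).trace = 0 := fun j => by
    have h2 := (hm.pderiv_scalar h0 hN j).symm.trans ((hG.pull hφ).pderiv_scalar ht h0 j)
    simp only [Matrix.trace, Matrix.diag, (hG.pull hφ).connDot_normal ht h0 hN]
    simpa using h2
  have hJ : IsUnit (jac φ 0).det := (hφ.det_ne 0 h0).isUnit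
  have h2 : ∀ j, ∑ a, jac φ 0 a j * (connDot G t a (φ 0)).trace = 0 := fun j => by
    rw [← h1 j]
    have h3 : connDot (fun t => RicciFlow.pull φ (G t)) t j 0 =
        (jac φ 0)⁻¹ * ((∑ a, jac φ 0 a j • connDot G t a (φ 0)) * jac φ 0) := by
      rw [← hG.jac_mul_connDot hφ ht h0, Matrix.nonsing_inv_mul_cancel_left _ _ hJ]
    rw [h3, Matrix.trace_mul_comm, Matrix.mul_assoc, Matrix.mul_nonsing_inv _ hJ, mul_one,
      Matrix.trace_sum]
    simp [Matrix.trace_smul]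
  have h3 : Matrix.vecMul (fun a => (connDot G t a (φ 0)).trace) (jac φ 0) = 0 := by
    ext j
    rw [Pi.zero_apply, ← h2 j]
    simp [Matrix.vecMul, dotProduct, mul_comm]
  exact congrFun (Matrix.eq_zero_of_vecMul_eq_zero (hφ.det_ne 0 h0) h3) i

/-- `g^{ij} ∂_t Γ^k_{ij} = 0`, by the contracted Bianchi identity. -/
lemma contract_connDot (ht : t ∈ T) (hy : y ∈ U) (k : Fin n) :
    ∑ i, (connDot G t i y * (G t y)⁻¹) k i = 0 := by
  -- The left hand side is a vector field, so it suffices to compute at the centre of normal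
  -- coordinates, where it equals `∂_k R - 2 ∂_i R_{ik}`.
  obtain ⟨φ, V, hφ, h0, rfl, hN⟩ := (hG.metric ht).exists_normal hy
  have hm := (hG.pull hφ).metric ht
  have h1 : ∀ k, ∑ i, connDot (fun t => RicciFlow.pull φ (G t)) t i 0 k i = 0 := fun k => by
    have h2 := hm.contracted_bianchi h0 hN k
    have h3 := hm.pderiv_scalar h0 hN k
    have h4 := (hG.pull hφ).pderiv_scalar ht h0 k
    have h5 : ∀ i, pderiv i (fun z => coordRicci (RicciFlow.pull φ (G t)) z i k) 0 =
        pderiv i (fun z => coordRicci (RicciFlow.pull φ (G t)) z k i) 0 := fun i =>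
      pderiv_congr_on i hφ.isOpen h0 fun z hz => (hG.pull hφ).ricci_symm ht hz i k
    simp only [(hG.pull hφ).connDot_normal ht h0 hN, Finset.sum_neg_distrib,
      Finset.sum_sub_distrib, Finset.sum_add_distrib, h5]
    linarith
  have hJ : IsUnit (jac φ 0).det := (hφ.det_ne 0 h0).isUnit
  have hinv : (G t (φ 0))⁻¹ = jac φ 0 * (jac φ 0).transpose := by
    have h2 : (jac φ 0).transpose * (G t (φ 0) * jac φ 0) = 1 := by
      rw [← Matrix.mul_assoc]; exact hN.eq_one
    have h3 := mul_eq_one_comm.1 h2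
    rw [Matrix.mul_assoc] at h3
    exact Matrix.inv_eq_right_inv h3
  have h2 : ∀ i, jac φ 0 * connDot (fun t => RicciFlow.pull φ (G t)) t i 0 = _ :=
    fun i => hG.jac_mul_connDot hφ ht h0 i
  calc ∑ i, (connDot G t i (φ 0) * (G t (φ 0))⁻¹) k i
      = ∑ j, ((∑ a, jac φ 0 a j • connDot G t a (φ 0)) * jac φ 0) k j := by
        rw [hinv]
        simp only [Matrix.mul_apply, Matrix.sum_apply, Matrix.smul_apply, smul_eq_mul,
          Matrix.transpose_apply, Finset.sum_mul, Finset.mul_sum]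
        rw [Finset.sum_congr rfl fun i _ => Finset.sum_comm, Finset.sum_comm]
        refine Finset.sum_congr rfl fun j _ => ?_
        rw [Finset.sum_comm]
        exact Finset.sum_congr rfl fun a _ => Finset.sum_congr rfl fun b _ => by ring
    _ = ∑ j, ∑ b, jac φ 0 k b * connDot (fun t => RicciFlow.pull φ (G t)) t j 0 b j := by
        refine Finset.sum_congr rfl fun j _ => ?_
        rw [← h2 j, Matrix.mul_apply]
    _ = 0 := by
        rw [Finset.sum_comm]
        simp only [← Finset.mul_sum, h1, mul_zero, Finset.sum_const_zero]

/-- At the centre of normal coordinates `∂_t g^{ij} = 2 R_{ij}`. -/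
lemma hasDerivAt_inv_normal (ht : t ∈ T) (hy : y ∈ U) (hN : IsNormalAt (G t) y) (i j : Fin n) :
    HasDerivAt (fun s => (G s y)⁻¹ i j) (2 * coordRicci (G t) y i j) t := by
  have hd := fun a b => (hG.smooth_inv a b).hasDerivAt hG.isOpen_time hG.isOpen ht hy
  have h1 := HasDerivAt.fun_sum (u := Finset.univ) fun l _ =>
    (hG.flow t ht y hy i l).fun_mul (hd l j)
  have h2 := hG.hasDerivAt_congr (h := fun _ => (1 : Mat n) i j) ht (fun s hs => ?_) h1
    (hasDerivAt_const _ _)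
  · refine (hd i j).congr_deriv ?_
    simp only [hN.eq_one, inv_one, Matrix.one_apply, Finset.sum_add_distrib] at h2
    simp at h2
    linarith
  · rw [← Matrix.mul_nonsing_inv (G s y) ((hG.metric hs).isUnit_det hy), Matrix.mul_apply]

/-- At the centre of normal coordinates,
`∂_t R_{jk} = ∂_i (∂_t Γ^i_{jk}) - ∂_j (∂_t Γ^i_{ik})`, and the last term vanishes. -/
lemma hasDerivAt_ricci_normal (ht : t ∈ T) (hy : y ∈ U) (hN : IsNormalAt (G t) y) (j k : Fin n) :
    HasDerivAt (fun s => coordRicci (G s) y j k)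
      (∑ i, pderiv i (fun z => connDot G t j z i k) y) t := by
  have hp : ∀ c i a b, HasDerivAt (fun s => pderiv c (fun z => conn (G s) i z a b) y)
      (pderiv c (fun z => connDot G t i z a b) y) t := fun c i a b =>
    (((hG.smooth_conn i a b).pderiv hG.isOpen_time hG.isOpen c).hasDerivAt hG.isOpen_time
      hG.isOpen ht hy).congr_deriv
      ((hG.smooth_conn i a b).tderiv_pderiv hG.isOpen_time hG.isOpen c ht hy)
  have hc := fun i a b => hG.hasDerivAt_conn ht hy i a b
  have hz : ∀ i a b, conn (G t) i y a b = 0 := fun i a b =>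
    congrFun (congrFun (hN.conn_eq_zero i) a) b
  have h1 := (HasDerivAt.fun_sum (u := Finset.univ) fun i _ =>
    (hp i j i k).fun_sub (hp j i i k)).fun_add
    (HasDerivAt.fun_sum (u := Finset.univ) fun i _ => HasDerivAt.fun_sum (u := Finset.univ)
      fun l _ => ((hc i i l).fun_mul (hc j l k)).fun_sub ((hc j i l).fun_mul (hc i l k)))
  have h2 : ∑ i, pderiv j (fun z => connDot G t i z i k) y = 0 := by
    rw [← pderiv_sum j _ fun i _ =>
      smooth_differentiableAt (hG.smooth_connDot ht i i k) hG.isOpen hy,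
      pderiv_congr_on (h := fun _ => 0) j hG.isOpen hy fun z hz => ?_, pderiv_const]
    rw [← hG.trace_connDot ht hz k]
    exact Finset.sum_congr rfl fun i _ => hG.connDot_symm ht hz i i k
  refine HasDerivAt.congr_deriv (f := fun s => coordRicci (G s) y j k) h1 ?_
  simp only [hz, mul_zero, zero_mul, add_zero, sub_zero, Finset.sum_const_zero,
    Finset.sum_sub_distrib, h2]

/-- The derivative of `g^{jk} ∂_t Γ^i_{jk} = 0` at the centre of normal coordinates, where `g^{jk}`
is `δ_{jk}` to first order. -/
lemma sum_pderiv_connDot_normal (ht : t ∈ T) (hy : y ∈ U) (hN : IsNormalAt (G t) y) (i : Fin n) :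
    ∑ j, pderiv i (fun z => connDot G t j z i j) y = 0 := by
  have hm := hG.metric ht
  have hs := fun j => hG.smooth_connDot ht j
  have h1 : pderiv i (fun z => ∑ j, (connDot G t j z * (G t z)⁻¹) i j) y = 0 := by
    rw [pderiv_congr_on (h := fun _ => 0) i hG.isOpen hy fun z hz =>
      hG.contract_connDot ht hz i, pderiv_const]
  rw [pderiv_sum i _ fun j _ =>
    smooth_differentiableAt ((hs j).mul hm.smooth_inv i j) hG.isOpen hy] at h1
  rw [← h1]
  refine Finset.sum_congr rfl fun j _ => ?_
  have h2 := mpderiv_mul i (hs j) hm.smooth_inv hG.isOpen hy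
  rw [hm.mpderiv_inv_eq_zero hy hN, hN.eq_one, inv_one, mul_one, mul_zero, add_zero] at h2
  exact (congrFun (congrFun h2 i) j).symm

/-- The evolution `r' = 2 |Ric|²` of a spatially constant scalar curvature, at the centre of normal
coordinates. -/
lemma hasDerivAt_scalar_normal (ht : t ∈ T) (hy : y ∈ U) (hN : IsNormalAt (G t) y) :
    HasDerivAt r (2 * ∑ j, ∑ k, coordRicci (G t) y j k ^ 2) t := by
  have h1 : HasDerivAt (fun s => coordScalar (G s) y)
      (∑ j, ∑ k, (2 * coordRicci (G t) y j k * coordRicci (G t) y j k +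
        (G t y)⁻¹ j k * ∑ i, pderiv i (fun z => connDot G t j z i k) y)) t :=
    HasDerivAt.fun_sum fun j _ => HasDerivAt.fun_sum fun k _ =>
      (hG.hasDerivAt_inv_normal ht hy hN j k).fun_mul (hG.hasDerivAt_ricci_normal ht hy hN j k)
  have h2 : r =ᶠ[𝓝 t] fun s => coordScalar (G s) y :=
    Filter.eventuallyEq_of_mem (hG.isOpen_time.mem_nhds ht) fun s hs => (hG.scalar s hs y hy).symm
  refine (h1.congr_of_eventuallyEq h2).congr_deriv ?_
  have h3 : ∑ j, ∑ k, (G t y)⁻¹ j k * ∑ i, pderiv i (fun z => connDot G t j z i k) y = 0 := by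
    simp only [hN.eq_one, inv_one, Matrix.one_apply, ite_mul, one_mul, zero_mul,
      Finset.sum_ite_eq, Finset.mem_univ, if_true]
    rw [Finset.sum_comm]
    exact Finset.sum_eq_zero fun i _ => hG.sum_pderiv_connDot_normal ht hy hN i
  simp only [Finset.sum_add_distrib]
  rw [h3, add_zero]
  simp only [Finset.mul_sum]
  exact Finset.sum_congr rfl fun j _ => Finset.sum_congr rfl fun k _ => by ring

/-- The differential inequality `r' ≥ (2/n) r²` for a spatially constant scalar curvature. -/
lemma exists_hasDerivAt_scalar (hne : U.Nonempty) (ht : t ∈ T) :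
    ∃ r', HasDerivAt r r' t ∧ 2 * r t ^ 2 ≤ n * r' := by
  obtain ⟨q, hq⟩ := hne
  obtain ⟨φ, V, hφ, h0, -, hN⟩ := (hG.metric ht).exists_normal hq
  have hG' := hG.pull hφ
  refine ⟨_, hG'.hasDerivAt_scalar_normal ht h0 hN, ?_⟩
  set R := coordRicci (RicciFlow.pull φ (G t)) 0
  have hr : r t = ∑ j, R j j := by
    rw [← hG'.scalar t ht 0 h0, coordScalar, hN.eq_one]
    simp [Matrix.one_apply, R]
  have h1 : (∑ j, R j j) ^ 2 ≤ n * ∑ j, R j j ^ 2 := by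
    simpa using sq_sum_le_card_mul_sum_sq (s := Finset.univ) (f := fun j => R j j)
  have h2 : ∑ j, R j j ^ 2 ≤ ∑ j, ∑ k, R j k ^ 2 := Finset.sum_le_sum fun j _ =>
    Finset.single_le_sum (f := fun k => R j k ^ 2) (fun k _ => sq_nonneg _) (Finset.mem_univ j)
  have h3 : (n : ℝ) * ∑ j, R j j ^ 2 ≤ n * ∑ j, ∑ k, R j k ^ 2 := by gcongr
  rw [hr]
  linarith

end IsLocalFlow

end Flow

/-! ### Charts of a Riemannian manifold -/

section Charts

variable {M : Type*} [TopologicalSpace M] [ChartedSpace (EuclideanSpace ℝ (Fin n)) M]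
  {e e' : OpenPartialHomeomorph M (EuclideanSpace ℝ (Fin n))}

lemma clm_apply_eq_sum (D : Coord n →L[ℝ] Coord n) (v : Coord n) :
    D v = ∑ a, v a • D (EuclideanSpace.single a 1) := by
  have hv : v = ∑ a, v a • EuclideanSpace.single a (1 : ℝ) := by
    ext k
    simp [Finset.sum_apply, Pi.single_apply]
  conv_lhs => rw [hv]
  simp

lemma fderiv_apply_eq_jac {φ : Coord n → Coord n} {y : Coord n} (hφ : DifferentiableAt ℝ φ y)
    (v : Coord n) (a : Fin n) : fderiv ℝ φ y v a = ∑ i, jac φ y a i * v i := by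
  have h2 : fderiv ℝ (fun z => φ z a) y = (EuclideanSpace.proj a : Coord n →L[ℝ] ℝ).comp
      (fderiv ℝ φ y) :=
    ((EuclideanSpace.proj a : Coord n →L[ℝ] ℝ).hasFDerivAt.comp y hφ.hasFDerivAt).fderiv
  have h3 : fderiv ℝ φ y v a = fderiv ℝ (fun z => φ z a) y v := by rw [h2]; rfl
  rw [h3, fderiv_eq_sum_pderiv]
  exact Finset.sum_congr rfl fun i _ => mul_comm _ _

/-- The derivative of the inverse of the chart `e`, with the tangent space of `M` read as `ℝⁿ`. -/
noncomputable def symmDeriv (e : OpenPartialHomeomorph M (EuclideanSpace ℝ (Fin n)))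
    (y : Coord n) : Coord n →L[ℝ] Coord n :=
  mfderiv (𝓡 n) (𝓡 n) e.symm y

/-- The transition map `e' ∘ e⁻¹`, defined on `e(dom e ∩ dom e')`, is smooth. -/
lemma smooth_chartChange (he : e ∈ IsManifold.maximalAtlas (𝓡 n) ∞ M)
    (he' : e' ∈ IsManifold.maximalAtlas (𝓡 n) ∞ M) :
    ContDiffOn ℝ ∞ (e' ∘ e.symm : Coord n → Coord n) (e.symm.trans e').source := by
  rw [← contMDiffOn_iff_contDiffOn]
  exact (contMDiffOn_of_mem_maximalAtlas he').comp
    ((contMDiffOn_symm_of_mem_maximalAtlas he).mono fun y hy => hy.1) fun y hy => hy.2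

lemma symmDeriv_chartChange (he : e ∈ IsManifold.maximalAtlas (𝓡 n) ∞ M)
    (he' : e' ∈ IsManifold.maximalAtlas (𝓡 n) ∞ M) {y : Coord n}
    (hy : y ∈ (e.symm.trans e').source) :
    symmDeriv e y = (symmDeriv e' (e' (e.symm y))).comp
      (fderiv ℝ (e' ∘ e.symm : Coord n → Coord n) y) := by
  have hV := (e.symm.trans e').open_source.mem_nhds hy
  have h1 : HasMFDerivAt (𝓡 n) (𝓡 n) e.symm y (symmDeriv e y) :=
    ((contMDiffAt_symm_of_mem_maximalAtlas he hy.1).mdifferentiableAt (by simp)).hasMFDerivAt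
  have h2 : HasMFDerivAt (𝓡 n) (𝓡 n) e'.symm (e' (e.symm y)) (symmDeriv e' (e' (e.symm y))) :=
    ((contMDiffAt_symm_of_mem_maximalAtlas he' (e'.map_source hy.2)).mdifferentiableAt
      (by simp)).hasMFDerivAt
  have h3 : HasMFDerivAt (𝓡 n) (𝓡 n) (e' ∘ e.symm : Coord n → Coord n) y
      (fderiv ℝ (e' ∘ e.symm : Coord n → Coord n) y) :=
    (((smooth_chartChange he he').contDiffAt hV).differentiableAt
      (by simp)).hasFDerivAt.hasMFDerivAt
  have h4 := (h2.comp y h3).congr_of_eventuallyEq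
    (f₁ := e.symm) (Filter.eventuallyEq_of_mem hV fun z hz => (e'.left_inv hz.2).symm)
  exact hasMFDerivAt_unique h1 h4

lemma differentiableAt_chartChange (he : e ∈ IsManifold.maximalAtlas (𝓡 n) ∞ M)
    (he' : e' ∈ IsManifold.maximalAtlas (𝓡 n) ∞ M) {y : Coord n}
    (hy : y ∈ (e.symm.trans e').source) :
    DifferentiableAt ℝ (e' ∘ e.symm : Coord n → Coord n) y :=
  ((smooth_chartChange he he').contDiffAt
    ((e.symm.trans e').open_source.mem_nhds hy)).differentiableAt (by simp)

variable [IsManifold (𝓡 n) ∞ M]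

/-- The inner product of `g` at `x`, with the tangent space of `M` at `x` read as `ℝⁿ`. -/
noncomputable def innerAt (g : Metric n M) (x : M) : Coord n →L[ℝ] Coord n →L[ℝ] ℝ := g.inner x

lemma metricMatrix_apply (g : Metric n M) (e : OpenPartialHomeomorph M (EuclideanSpace ℝ (Fin n)))
    (y : Coord n) (i j : Fin n) : metricMatrix g e y i j =
      innerAt g (e.symm y) (symmDeriv e y (EuclideanSpace.single i 1))
        (symmDeriv e y (EuclideanSpace.single j 1)) := rfl

lemma symmDeriv_injective (x : M) {y : Coord n}
    (hy : y ∈ (chartAt (EuclideanSpace ℝ (Fin n)) x).target) :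
    Function.Injective (symmDeriv (chartAt (EuclideanSpace ℝ (Fin n)) x) y) :=
  haveI : IsManifold (𝓡 n) 1 M := IsManifold.of_le (n := ∞) (by simp)
  (mdifferentiable_chart (I := 𝓡 n) x).symm.mfderiv_injective hy

lemma posDef_metricMatrix (g : Metric n M) (x : M) {y : Coord n}
    (hy : y ∈ (chartAt (EuclideanSpace ℝ (Fin n)) x).target) :
    (metricMatrix g (chartAt (EuclideanSpace ℝ (Fin n)) x) y).PosDef := by
  set e := chartAt (EuclideanSpace ℝ (Fin n)) x
  refine Matrix.PosDef.of_dotProduct_mulVec_pos ?_ fun v hv => ?_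
  · ext i j
    exact g.symm _ _ _
  · have hv' : symmDeriv e y (WithLp.toLp 2 v) ≠ 0 := fun h => hv <| by
      have h0 := symmDeriv_injective x hy (h.trans (map_zero _).symm)
      exact congrArg WithLp.ofLp h0
    have hpos : 0 < innerAt g (e.symm y) (symmDeriv e y (WithLp.toLp 2 v))
      (symmDeriv e y (WithLp.toLp 2 v)) := g.pos _ _ hv'
    rw [clm_apply_eq_sum] at hpos
    simp only [map_sum, map_smul, sum_apply, smul_apply,
      smul_eq_mul, ← metricMatrix_apply] at hpos
    simp only [dotProduct, Matrix.mulVec, Pi.star_apply, star_trivial, Finset.mul_sum]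
    simp only [Finset.mul_sum] at hpos
    rw [Finset.sum_comm]
    refine hpos.trans_eq (Finset.sum_congr rfl fun i _ => Finset.sum_congr rfl fun j _ => ?_)
    ring

lemma metricMatrix_eq_pull (g : Metric n M) (he : e ∈ IsManifold.maximalAtlas (𝓡 n) ∞ M)
    (he' : e' ∈ IsManifold.maximalAtlas (𝓡 n) ∞ M) {y : Coord n}
    (hy : y ∈ (e.symm.trans e').source) :
    metricMatrix g e y = pull (e' ∘ e.symm) (metricMatrix g e') y := by
  have hv : ∀ i, symmDeriv e y (EuclideanSpace.single i 1) = ∑ a, jac (e' ∘ e.symm) y a i •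
      symmDeriv e' (e' (e.symm y)) (EuclideanSpace.single a 1) := fun i => by
    rw [symmDeriv_chartChange he he' hy, ContinuousLinearMap.comp_apply, clm_apply_eq_sum]
    refine Finset.sum_congr rfl fun a _ => ?_
    rw [fderiv_apply_eq_jac (differentiableAt_chartChange he he' hy)]
    simp
  have hl : e'.symm (e' (e.symm y)) = e.symm y := e'.left_inv hy.2
  ext i j
  rw [metricMatrix_apply, hv, hv]
  simp only [map_sum, map_smul, sum_apply, smul_apply,
    smul_eq_mul, pull, Matrix.mul_apply, Matrix.transpose_apply, metricMatrix_apply,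
    Function.comp_apply, hl, Finset.mul_sum, Finset.sum_mul]
  refine Finset.sum_congr rfl fun a _ => Finset.sum_congr rfl fun b _ => ?_
  ring

lemma isCoordChange_chartAt (x x' : M) :
    IsCoordChange (chartAt (EuclideanSpace ℝ (Fin n)) x' ∘
        (chartAt (EuclideanSpace ℝ (Fin n)) x).symm)
      ((chartAt (EuclideanSpace ℝ (Fin n)) x).symm.trans
        (chartAt (EuclideanSpace ℝ (Fin n)) x')).source
      (chartAt (EuclideanSpace ℝ (Fin n)) x').target := by
  have he := IsManifold.chart_mem_maximalAtlas (I := 𝓡 n) (n := ∞) x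
  have he' := IsManifold.chart_mem_maximalAtlas (I := 𝓡 n) (n := ∞) x'
  refine ⟨OpenPartialHomeomorph.open_source _, fun y hy => OpenPartialHomeomorph.map_source _ hy.2,
    smooth_chartChange he he', fun y hy => ?_⟩
  have hinj : Function.Injective (jac (chartAt (EuclideanSpace ℝ (Fin n)) x' ∘
      (chartAt (EuclideanSpace ℝ (Fin n)) x).symm) y).mulVec := by
    refine (injective_iff_map_eq_zero (Matrix.mulVecLin _)).2 fun v hv => ?_
    have h1 : fderiv ℝ (chartAt (EuclideanSpace ℝ (Fin n)) x' ∘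
        (chartAt (EuclideanSpace ℝ (Fin n)) x).symm : Coord n → Coord n) y
        (WithLp.toLp 2 v) = 0 := by
      ext a
      rw [fderiv_apply_eq_jac (differentiableAt_chartChange he he' hy)]
      exact congrFun hv a
    have h2 : symmDeriv (chartAt (EuclideanSpace ℝ (Fin n)) x) y (WithLp.toLp 2 v) = 0 := by
      rw [symmDeriv_chartChange he he' hy, ContinuousLinearMap.comp_apply, h1, map_zero]
    exact congrArg WithLp.ofLp (symmDeriv_injective x hy.1 (h2.trans (map_zero _).symm))
  exact ((Matrix.isUnit_iff_isUnit_det _).1 (Matrix.mulVec_injective_iff_isUnit.1 hinj)).ne_zero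

variable {g : ℝ → Metric n M} {T : Set ℝ}

lemma IsRicciFlow.isCoordMetric (hg : IsRicciFlow g T) (x : M) {t : ℝ} (ht : t ∈ T) :
    IsCoordMetric (metricMatrix (g t) (chartAt (EuclideanSpace ℝ (Fin n)) x))
      (chartAt (EuclideanSpace ℝ (Fin n)) x).target where
  isOpen := OpenPartialHomeomorph.open_target _
  smooth := fun i j => JointSmooth.space
    (f := fun t y => metricMatrix (g t) (chartAt (EuclideanSpace ℝ (Fin n)) x) y i j)
    (hg.smooth _ (IsManifold.chart_mem_maximalAtlas x) i j) ht
  posDef := fun _ hy => posDef_metricMatrix _ _ hy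

/-- The scalar curvature may be computed in any preferred chart. -/
lemma IsRicciFlow.coordScalar_eq (hg : IsRicciFlow g T) (x : M) {t : ℝ} (ht : t ∈ T) {y : Coord n}
    (hy : y ∈ (chartAt (EuclideanSpace ℝ (Fin n)) x).target) :
    coordScalar (metricMatrix (g t) (chartAt (EuclideanSpace ℝ (Fin n)) x)) y =
      scalarCurvature (g t) ((chartAt (EuclideanSpace ℝ (Fin n)) x).symm y) := by
  set e := chartAt (EuclideanSpace ℝ (Fin n)) x
  have hc := isCoordChange_chartAt (n := n) x (e.symm y)
  have hyV : y ∈ (e.symm.trans (chartAt (EuclideanSpace ℝ (Fin n)) (e.symm y))).source :=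
    ⟨hy, mem_chart_source _ _⟩
  have hm := hg.isCoordMetric (e.symm y) ht
  have h1 := hc.scalar_pull hm hyV
  have h2 : ∀ z ∈ (e.symm.trans (chartAt (EuclideanSpace ℝ (Fin n)) (e.symm y))).source,
      metricMatrix (g t) e z = pull (chartAt (EuclideanSpace ℝ (Fin n)) (e.symm y) ∘ e.symm)
        (metricMatrix (g t) (chartAt (EuclideanSpace ℝ (Fin n)) (e.symm y))) z := fun z hz =>
    metricMatrix_eq_pull _ (IsManifold.chart_mem_maximalAtlas x)
      (IsManifold.chart_mem_maximalAtlas _) hz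
  rw [coordScalar_congr hc.isOpen h2 hyV, h1]
  rfl

/-- A Ricci flow with spatially constant scalar curvature, read in a preferred chart. -/
lemma IsRicciFlow.isLocalFlow (hg : IsRicciFlow g T) (hT : IsOpen T)
    (hR : ∀ t ∈ T, ∀ x y : M, scalarCurvature (g t) x = scalarCurvature (g t) y) (x : M) :
    IsLocalFlow (fun t => metricMatrix (g t) (chartAt (EuclideanSpace ℝ (Fin n)) x)) T
      (chartAt (EuclideanSpace ℝ (Fin n)) x).target (fun t => scalarCurvature (g t) x) where
  isOpen_time := hT
  isOpen := OpenPartialHomeomorph.open_target _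
  smooth := hg.smooth _ (IsManifold.chart_mem_maximalAtlas x)
  posDef := fun _ _ _ hy => posDef_metricMatrix _ _ hy
  flow := hg.flow _ (IsManifold.chart_mem_maximalAtlas x)
  scalar := fun t ht _ hy => (hg.coordScalar_eq x ht hy).trans (hR t ht _ _)

end Charts

/-! ### The differential inequality -/

section Comparison

lemma isOpen_timeInterval (α β : EReal) : IsOpen (timeInterval α β) :=
  (isOpen_lt continuous_const continuous_coe_real_ereal).inter
    (isOpen_lt continuous_coe_real_ereal continuous_const)

/-- A positive solution of `n r' ≥ 2 r²` blows up by the time `n / (2 r(0))`. -/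
lemma le_of_riccati {α β : EReal} (hα : α < 0) {r : ℝ → ℝ}
    (hr : ∀ t ∈ timeInterval α β, ∃ r', HasDerivAt r r' t ∧ 2 * r t ^ 2 ≤ n * r')
    (hn : 0 < n) (h0 : 0 < r 0) : β ≤ (((n : ℝ) / 2 * (r 0)⁻¹ : ℝ) : EReal) := by
  have hn' : (0 : ℝ) < n := by exact_mod_cast hn
  by_contra! hβ
  set c : ℝ := (n : ℝ) / 2 * (r 0)⁻¹ with hc
  have hc0 : 0 < c := by positivity
  have hI : ∀ t ∈ Set.Icc 0 c, t ∈ timeInterval α β := fun t ht =>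
    ⟨hα.trans_le (by exact_mod_cast ht.1), lt_of_le_of_lt (by exact_mod_cast ht.2) hβ⟩
  choose! r' hd hle using hr
  have hmono : MonotoneOn r (Set.Icc 0 c) := by
    refine monotoneOn_of_deriv_nonneg (convex_Icc 0 c)
      (fun t ht => (hd t (hI t ht)).continuousAt.continuousWithinAt)
      (fun t ht => (hd t (hI t (interior_subset ht))).differentiableAt.differentiableWithinAt)
      fun t ht => ?_
    rw [(hd t (hI t (interior_subset ht))).deriv]
    have h1 := hle t (hI t (interior_subset ht))
    have h2 : 0 ≤ (n : ℝ) * r' t := le_trans (by positivity) h1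
    exact nonneg_of_mul_nonneg_right h2 hn'
  have hpos : ∀ t ∈ Set.Icc 0 c, 0 < r t := fun t ht =>
    h0.trans_le (hmono ⟨le_rfl, hc0.le⟩ ht ht.1)
  have hf : ∀ t ∈ Set.Icc 0 c, HasDerivAt (fun s => (r s)⁻¹ + 2 / n * s)
      (-r' t / r t ^ 2 + 2 / n) t := fun t ht =>
    (((hd t (hI t ht)).fun_inv (hpos t ht).ne').fun_add
      ((hasDerivAt_id t).const_mul (2 / n : ℝ))).congr_deriv (by simp)
  -- Since `(1/r)' = -r'/r² ≤ -2/n`, the function `1/r + (2/n) t` is non-increasing on `[0, c]`, and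
  -- at `t = c` this would force `1/r(c) ≤ 0`.
  have hanti : AntitoneOn (fun s => (r s)⁻¹ + 2 / n * s) (Set.Icc 0 c) := by
    refine antitoneOn_of_deriv_nonpos (convex_Icc 0 c)
      (fun t ht => (hf t ht).continuousAt.continuousWithinAt)
      (fun t ht => (hf t (interior_subset ht)).differentiableAt.differentiableWithinAt)
      fun t ht => ?_
    rw [(hf t (interior_subset ht)).deriv]
    have h1 := hle t (hI t (interior_subset ht))
    have h2 := hpos t (interior_subset ht)
    have h3 : 2 / (n : ℝ) ≤ r' t / r t ^ 2 := by
      rw [div_le_div_iff₀ hn' (by positivity)]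
      linarith
    rw [neg_div]
    linarith
  have h1 := hanti ⟨le_rfl, hc0.le⟩ ⟨hc0.le, le_rfl⟩ hc0.le
  have h2 : 2 / (n : ℝ) * c = (r 0)⁻¹ := by
    rw [hc]
    field_simp
  have h3 : 0 < (r c)⁻¹ := inv_pos.2 (hpos c ⟨hc0.le, le_rfl⟩)
  simp only [mul_zero, add_zero, h2] at h1
  linarith

/-- A negative solution of `n r' ≥ 2 r²` cannot be continued backwards past `n / (2 r(0))`: apply
the forward estimate to `t ↦ -r(-t)`. -/
lemma le_of_riccati_neg {α β : EReal} (hβ : 0 < β) {r : ℝ → ℝ}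
    (hr : ∀ t ∈ timeInterval α β, ∃ r', HasDerivAt r r' t ∧ 2 * r t ^ 2 ≤ n * r')
    (hn : 0 < n) (h0 : r 0 < 0) : (((n : ℝ) / 2 * (r 0)⁻¹ : ℝ) : EReal) ≤ α := by
  have h1 := le_of_riccati (α := -β) (β := -α) (r := fun t => -r (-t))
    (by simpa using EReal.neg_lt_neg_iff.2 hβ) (fun t ht => ?_) hn (by simpa using h0)
  · have h2 := EReal.neg_le_neg_iff.2 h1
    rw [neg_neg, ← EReal.coe_neg] at h2
    simpa using h2
  · obtain ⟨r', hd, hle⟩ := hr (-t) ⟨by simpa using EReal.lt_neg_comm.1 ht.2,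
      by simpa using EReal.neg_lt_comm.1 ht.1⟩
    refine ⟨r', ?_, by simpa using hle⟩
    exact (hd.scomp t (hasDerivAt_neg t)).fun_neg.congr_deriv (by simp)

end Comparison

end RicciFlow

theorem mainTheorem3 (n : ℕ) (M : Type*) [TopologicalSpace M] [T2Space M]
    [SecondCountableTopology M] [ConnectedSpace M]
    [ChartedSpace (EuclideanSpace ℝ (Fin n)) M] [IsManifold (𝓡 n) ∞ M]
    (α β : EReal) (hα : α < 0) (hβ : 0 < β)
    (g : ℝ → RicciFlow.Metric n M)
    (hg : RicciFlow.IsRicciFlow g (RicciFlow.timeInterval α β))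
    (hR : ∀ t ∈ RicciFlow.timeInterval α β, ∀ x y : M,
      RicciFlow.scalarCurvature (g t) x = RicciFlow.scalarCurvature (g t) y) (x₀ : M) :
    (0 < RicciFlow.scalarCurvature (g 0) x₀ →
      β ≤ (((n : ℝ) / 2 * (RicciFlow.scalarCurvature (g 0) x₀)⁻¹ : ℝ) : EReal)) ∧
    (RicciFlow.scalarCurvature (g 0) x₀ < 0 →
      (((n : ℝ) / 2 * (RicciFlow.scalarCurvature (g 0) x₀)⁻¹ : ℝ) : EReal) ≤ α) := by
  have hflow := hg.isLocalFlow (RicciFlow.isOpen_timeInterval α β) hR x₀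
  have hr := fun t ht => hflow.exists_hasDerivAt_scalar (t := t)
    ⟨_, mem_chart_target (EuclideanSpace ℝ (Fin n)) x₀⟩ ht
  -- In dimension `0` the scalar curvature is an empty sum.
  have hn : RicciFlow.scalarCurvature (g 0) x₀ ≠ 0 → 0 < n := fun h => by
    rcases Nat.eq_zero_or_pos n with rfl | hn
    · exact absurd (by simp [RicciFlow.scalarCurvature, RicciFlow.coordScalar]) h
    · exact hn
  exact ⟨fun h => RicciFlow.le_of_riccati hα hr (hn h.ne') h,
    fun h => RicciFlow.le_of_riccati_neg hβ hr (hn h.ne) h⟩
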